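/- For $q\ge 3$ let $\delta_q$ be the infimum of the constants $c$ for which there is an algorithm solving $q$-SAT with $n$ variables and $m$ clauses in time $2^{cn}\cdot m^{O(1)}$; the Strong Exponential Time Hypothesis (SETH) is the conjecture that $\lim_{q\to\infty}\delta_q=1$. A graph is chordal if it has no induced cycle of length at least $4$, and a set $S$ of vertices of a graph $G$ is a chordal vertex deletion set of $G$ if $G-S$ is chordal. Consider the following two problems, in which the input is a finite simple graph $G$, numbers $k,\ell\in\mathbb N$ and a chordal vertex deletion set $S$ of $G$ with $|S|=k$, and the parameter is $k$. - Feedback Vertex Set by CVD, with the modulator given: is there a set $X\subseteq V(G)$ with $|X|\le\ell$ such that $G-X$ is a forest? - Odd Cycle Transversal by CVD, with the modulator given: is there a set $X\subseteq V(G)$ with $|X|\le\ell$ such that $G-X$ is bipartite? Assume SETH. Then for every $\varepsilon>0$ neither of the two problems can be solved in time $O^*((2-\varepsilon)^k)$, that is, in time $(2-\varepsilon)^k$ times a polynomial in the length of the input. -/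

import Mathlib

/-! ## A random access machine with logarithmic cost

The machine has registers `R 0, R 1, …` and arrays `A 0, A 1, …`, each array being an infinite
sequence of cells; registers and cells hold natural numbers.  A program names finitely many
registers and arrays, and the instruction set is the usual one (constants, addition, truncated
subtraction, indirect reading and writing of memory, tests for zero), with structured control
flow in the place of jumps.  Every instruction is charged the binary lengths of the numbers and of
the addresses that it handles (logarithmic cost). -/

namespace RAM

/-- A configuration of the memory. -/
@[ext]
structure State where
  /-- the contents of the registers -/
  reg : ℕ → ℕ
  /-- `arr a i` is the content of cell `i` of array `a` -/
  arr : ℕ → ℕ → ℕ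

/-- `R i := v`. -/
def State.setReg (s : State) (i v : ℕ) : State :=
  { s with reg := Function.update s.reg i v }

/-- `A a [p] := v`. -/
def State.setArr (s : State) (a p v : ℕ) : State :=
  { s with arr := Function.update s.arr a (Function.update (s.arr a) p v) }

/-- Programs of the machine. -/
inductive Prog where
  /-- `R i := c` -/
  | const (i c : ℕ)
  /-- `R i := R j + R k` -/
  | add (i j k : ℕ)
  /-- `R i := R j - R k` (zero if `R j < R k`) -/
  | sub (i j k : ℕ)
  /-- `R i := A a [R j]` -/
  | load (i a j : ℕ)
  /-- `A a [R i] := R j` -/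
  | store (a i j : ℕ)
  /-- `p; q` -/
  | seq (p q : Prog)
  /-- `if R i ≠ 0 then p else q` -/
  | cond (i : ℕ) (p q : Prog)
  /-- `while R i ≠ 0 do p` -/
  | loop (i : ℕ) (p : Prog)

/-- `Exec p s t s'`: the program `p`, started in the configuration `s`, halts in the configuration
`s'` after time `t`. -/
inductive Exec : Prog → State → ℕ → State → Prop where
  | const (s : State) (i c : ℕ) :
      Exec (.const i c) s (1 + c.size) (s.setReg i c)
  | add (s : State) (i j k : ℕ) :
      Exec (.add i j k) s (1 + (s.reg j).size + (s.reg k).size)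
        (s.setReg i (s.reg j + s.reg k))
  | sub (s : State) (i j k : ℕ) :
      Exec (.sub i j k) s (1 + (s.reg j).size + (s.reg k).size)
        (s.setReg i (s.reg j - s.reg k))
  | load (s : State) (i a j : ℕ) :
      Exec (.load i a j) s (1 + (s.reg j).size + (s.arr a (s.reg j)).size)
        (s.setReg i (s.arr a (s.reg j)))
  | store (s : State) (a i j : ℕ) :
      Exec (.store a i j) s (1 + (s.reg i).size + (s.reg j).size)
        (s.setArr a (s.reg i) (s.reg j))
  | seq {p q : Prog} {s s' s'' : State} {t t' : ℕ} :
      Exec p s t s' → Exec q s' t' s'' → Exec (.seq p q) s (t + t') s''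
  | cond_true {i : ℕ} {p q : Prog} {s s' : State} {t : ℕ} :
      s.reg i ≠ 0 → Exec p s t s' → Exec (.cond i p q) s (1 + (s.reg i).size + t) s'
  | cond_false {i : ℕ} {p q : Prog} {s s' : State} {t : ℕ} :
      s.reg i = 0 → Exec q s t s' → Exec (.cond i p q) s (1 + t) s'
  | loop_true {i : ℕ} {p : Prog} {s s' s'' : State} {t t' : ℕ} :
      s.reg i ≠ 0 → Exec p s t s' → Exec (.loop i p) s' t' s'' →
      Exec (.loop i p) s (1 + (s.reg i).size + t + t') s''
  | loop_false {i : ℕ} {p : Prog} {s : State} :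
      s.reg i = 0 → Exec (.loop i p) s 1 s

/-- The machine is deterministic: running time and result are unique. -/
theorem Exec.deterministic {p : Prog} {s s₁ s₂ : State} {t₁ t₂ : ℕ}
    (h₁ : Exec p s t₁ s₁) (h₂ : Exec p s t₂ s₂) : t₁ = t₂ ∧ s₁ = s₂ := by
  induction h₁ generalizing t₂ s₂ with
  | const | add | sub | load | store => cases h₂; exact ⟨rfl, rfl⟩
  | seq _ _ ih ih' =>
    cases h₂ with
    | seq a b =>
      obtain ⟨rfl, rfl⟩ := ih a
      obtain ⟨rfl, rfl⟩ := ih' b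
      exact ⟨rfl, rfl⟩
  | cond_true h _ ih =>
    cases h₂ with
    | cond_true _ a => obtain ⟨rfl, rfl⟩ := ih a; exact ⟨rfl, rfl⟩
    | cond_false h' _ => exact absurd h' h
  | cond_false h _ ih =>
    cases h₂ with
    | cond_true h' _ => exact absurd h h'
    | cond_false _ a => obtain ⟨rfl, rfl⟩ := ih a; exact ⟨rfl, rfl⟩
  | loop_true h _ _ ih ih' =>
    cases h₂ with
    | loop_true _ a b =>
      obtain ⟨rfl, rfl⟩ := ih a
      obtain ⟨rfl, rfl⟩ := ih' b
      exact ⟨rfl, rfl⟩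
    | loop_false h' => exact absurd h' h
  | loop_false h =>
    cases h₂ with
    | loop_true h' _ _ => exact absurd h h'
    | loop_false _ => exact ⟨rfl, rfl⟩

/-- The initial configuration on the input word `w`: the word stands at the beginning of array `0`
and its number of letters in register `0`; everything else is zero. -/
def initial (w : List ℕ) : State where
  reg i := if i = 0 then w.length else 0
  arr a i := if a = 0 then w.getD i 0 else 0

/-- The length of an input word: the total length of its numbers in binary, with one separator for
each. -/
def inputLength (w : List ℕ) : ℕ := (w.map fun a => a.size + 1).sum

end RAM

/-- A decision problem: instances, their encodings as input words, and the yes-instances. -/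
structure DecisionProblem where
  /-- the instances -/
  Instance : Type
  /-- the input word of an instance -/
  encode : Instance → List ℕ
  /-- the instances with answer yes -/
  IsYes : Instance → Prop

/-- There is an algorithm that solves the problem and takes time at most `T x` on every instance
`x`.  (The answer is yes if register `0` is nonzero in the end.) -/
def DecisionProblem.SolvableInTime (P : DecisionProblem) (T : P.Instance → ℝ) : Prop :=
  ∃ p : RAM.Prog, ∀ x : P.Instance, ∃ (t : ℕ) (s : RAM.State),
    RAM.Exec p (RAM.initial (P.encode x)) t s ∧ (s.reg 0 ≠ 0 ↔ P.IsYes x) ∧ (t : ℝ) ≤ T x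

/-- The problem, with parameter `k`, can be solved in time `O*(b ^ k)`, that is, in time
`b ^ k` times a polynomial in the length of the input. -/
def DecisionProblem.SolvableInOStar (P : DecisionProblem) (k : P.Instance → ℕ) (b : ℝ) : Prop :=
  ∃ C d : ℕ, P.SolvableInTime fun x =>
    C * b ^ k x * (RAM.inputLength (P.encode x) : ℝ) ^ d

/-! ## The Strong Exponential Time Hypothesis -/

/-- A formula in conjunctive normal form over the variables `0, …, n - 1`.  The literal `(i, true)`
is the variable `i` and `(i, false)` its negation. -/
structure CNFFormula where
  /-- the number of variables -/
  n : ℕ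
  /-- the list of clauses -/
  clauses : List (List (Fin n × Bool))

namespace CNFFormula

/-- Some assignment makes a literal of every clause true. -/
def Satisfiable (φ : CNFFormula) : Prop :=
  ∃ a : Fin φ.n → Bool, ∀ c ∈ φ.clauses, ∃ l ∈ c, a l.1 = l.2

/-- The input word of a formula: number of variables, number of clauses, and for each clause its
number of literals followed by the literals, `2 * i + 1` for the variable `i` and `2 * i` for its
negation. -/
def encode (φ : CNFFormula) : List ℕ :=
  φ.n :: φ.clauses.length ::
    φ.clauses.flatMap fun c => c.length :: c.map fun l => 2 * (l.1 : ℕ) + l.2.toNat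

end CNFFormula

/-- `q`-SAT: satisfiability of formulas in which every clause has at most `q` literals. -/
def qSAT (q : ℕ) : DecisionProblem where
  Instance := {φ : CNFFormula // ∀ c ∈ φ.clauses, c.length ≤ q}
  encode φ := φ.1.encode
  IsYes φ := φ.1.Satisfiable

/-- `δ_q`: the infimum of the constants `c` such that `q`-SAT with `n` variables and `m` clauses can
be solved in time `2 ^ (c n) * m ^ O(1)`.  (It is `m + 1` here so that formulas without clauses are
not excluded.) -/
noncomputable def satExponent (q : ℕ) : ℝ :=
  sInf {c : ℝ | 0 ≤ c ∧ ∃ C d : ℕ, (qSAT q).SolvableInTime fun φ =>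
    C * (2 : ℝ) ^ (c * (φ.1.n : ℝ)) * ((φ.1.clauses.length : ℝ) + 1) ^ d}

/-- The Strong Exponential Time Hypothesis. -/
def SETH : Prop :=
  Filter.Tendsto satExponent Filter.atTop (nhds 1)

/-! ## Graph problems with a chordal vertex deletion set -/

/-- A graph is chordal if it has no induced cycle of length at least four. -/
def SimpleGraph.IsChordal {V : Type*} (G : SimpleGraph V) : Prop :=
  ∀ m : ℕ, 4 ≤ m → IsEmpty (SimpleGraph.cycleGraph m ↪g G)

/-- `G - X`. -/
abbrev SimpleGraph.minus {V : Type*} (G : SimpleGraph V) (X : Finset V) :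
    SimpleGraph ((X : Set V)ᶜ : Set V) :=
  G.induce ((X : Set V)ᶜ)

/-- `S` is a chordal vertex deletion set of `G`. -/
def SimpleGraph.IsCVD {V : Type*} (G : SimpleGraph V) (S : Finset V) : Prop :=
  (G.minus S).IsChordal

/-- A graph `G`, numbers `k` and `ℓ`, and a given chordal vertex deletion set of `G` of size `k`. -/
structure CVDInstance where
  /-- the number of vertices -/
  n : ℕ
  /-- the graph -/
  G : SimpleGraph (Fin n)
  /-- the parameter -/
  k : ℕ
  /-- the bound on the size of a solution -/
  ℓ : ℕ
  /-- the modulator -/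
  S : Finset (Fin n)
  card_S : S.card = k
  isCVD : G.IsCVD S

open Classical in
/-- The input word of an instance: `n`, `k`, `ℓ`, the adjacency matrix row by row, and the
characteristic vector of the modulator. -/
noncomputable def CVDInstance.encode (I : CVDInstance) : List ℕ :=
  [I.n, I.k, I.ℓ] ++
    ((List.finRange I.n).flatMap fun u =>
      (List.finRange I.n).map fun v => if I.G.Adj u v then 1 else 0) ++
    (List.finRange I.n).map fun v => if v ∈ I.S then 1 else 0

/-- Feedback Vertex Set by CVD, with the modulator given: is there a set `X` of at most `ℓ` vertices
such that `G - X` is a forest? -/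
noncomputable def FVSbyCVD : DecisionProblem where
  Instance := CVDInstance
  encode := CVDInstance.encode
  IsYes I := ∃ X : Finset (Fin I.n), X.card ≤ I.ℓ ∧ (I.G.minus X).IsAcyclic

/-- Odd Cycle Transversal by CVD, with the modulator given: is there a set `X` of at most `ℓ`
vertices such that `G - X` is bipartite? -/
noncomputable def OCTbyCVD : DecisionProblem where
  Instance := CVDInstance
  encode := CVDInstance.encode
  IsYes I := ∃ X : Finset (Fin I.n), X.card ≤ I.ℓ ∧ (I.G.minus X).IsBipartite

/-! # Feedback Vertex Set and Odd Cycle Transversal with a chordal vertex deletion set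

An algorithm with running time `O*((2 - ε) ^ k)` for either problem would solve `q`-SAT in time
`2 ^ (c * n) * m ^ O(1)` with a constant `c < 1` that does not depend on `q`, against SETH.  This
follows from one polynomial-time reduction that serves both problems.

Divide the variables into blocks of `g`.  A block gets `2 * h` vertices of the modulator `S`, and
its `2 ^ g` assignments are encoded by distinct `h`-subsets of them (`BalancedCode`); as
`2 ^ g ≤ centralBinom h` is possible with `2 * h / g` near `1` (`exists_balancedCode`), `|S|` is
close to `n`.  Every clause and every block gets a gadget, in `|S|` copies.  Its slots form a
clique and stand for the ways to satisfy the clause (a literal together with an assignment of its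
block) or for the assignments of the block.  The slot `w` *requires* the deletion of a set
`A w ⊆ S`, the code set of its assignment: for each `x ∈ A w` there is a triangle formed by `w`,
`x` and a pendant vertex of their own.  Two further vertices, the apices, are joined to all slots.
The slots are a clique and all other vertices outside `S` are simplicial in `G - S`, so `G - S` is
chordal (`Gadget.chordal`).

A set that meets all triangles contains all slots of a gadget but one, or else it pays at least one
vertex more in that gadget; and if it pays the minimum, then it contains all of `A w` for the
remaining slot `w` (`Gadget.exists_slot_of_part_lt`).  With more copies than the budget `h` per
block, some copy of every gadget is paid at the minimum (`Gadget.exists_cover`), so the set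
contains a code set in each block and, by the budget, nothing else of `S`: it is an assignment, and
the gadgets of the clauses say that it is satisfying
(`CNFFormula.satisfiable_iff_exists_cover`).  Conversely, a satisfying assignment gives a set of
the right size whose deletion leaves a disjoint union of stars (`Gadget.exists_deletion`).  Forests
and bipartite graphs have no triangles, and stars are both, so the same graph is right for both
problems.

The reduction has to be carried out on the random access machine.  It is written in a small
language with arithmetic expressions and loops whose number of rounds is fixed in advance, and a
verified compiler translates it (`RAM.Stmt.run_compile`).  Since only a polynomial bound matters,
every instruction is charged the values of its operands instead of their lengths.  The compiled
program uses registers and arrays that the given algorithm for the graph problem does not name, so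
that the two can be run one after the other (`RAM.exists_exec_comp`).
-/

/-! ### Star forests and chordal graphs -/

namespace SimpleGraph

/-- A graph is a forest if every edge has an endpoint of degree at most one. -/
theorem isAcyclic_of_leaves {V : Type*} (G : SimpleGraph V) (leaf : V → Prop)
    (hedge : ∀ u v, G.Adj u v → leaf u ∨ leaf v)
    (hleaf : ∀ u a b, leaf u → G.Adj u a → G.Adj u b → a = b) : G.IsAcyclic := by
  intro v c hc
  have hno : ∀ u ∈ c.support, ¬ leaf u := by
    intro u hu hl
    have h2 := hc.ncard_neighborSet_toSubgraph_eq_two hu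
    -- a vertex of a cycle has two neighbours on it
    obtain ⟨a, b, hab, hs⟩ := Set.ncard_eq_two.mp h2
    have ha : a ∈ c.toSubgraph.neighborSet u := by rw [hs]; simp
    have hb : b ∈ c.toSubgraph.neighborSet u := by rw [hs]; simp
    exact hab (hleaf u a b hl (c.toSubgraph.adj_sub ha) (c.toSubgraph.adj_sub hb))
  have hadj : G.Adj v (c.getVert 1) := by
    have := c.adj_getVert_succ (i := 0) (by have := hc.three_le_length; omega)
    simpa using this
  rcases hedge _ _ hadj with h | h
  · exact hno _ c.start_mem_support h
  · exact hno _ (c.getVert_mem_support 1) h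

/-- A graph is chordal if every vertex outside `K` is simplicial and adjacency is transitive on
`K`: an induced cycle of length at least four has no simplicial vertex, so it would lie in `K`. -/
theorem isChordal_of_simplicial {V : Type*} (G : SimpleGraph V) (K : V → Prop)
    (hsimp : ∀ u a b, ¬ K u → G.Adj u a → G.Adj u b → a ≠ b → G.Adj a b)
    (htrans : ∀ u v w, K u → K v → K w → G.Adj u v → G.Adj v w → u ≠ w → G.Adj u w) :
    G.IsChordal := by
  intro m hm
  obtain ⟨m, rfl⟩ := Nat.exists_eq_add_of_le' hm
  refine ⟨fun f => ?_⟩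
  have e1 : ∀ i : Fin (m + 4), (cycleGraph (m + 4)).Adj i (i + 1) := fun i => by
    rw [cycleGraph_adj]; right; abel
  have e2 : ∀ i : Fin (m + 4), (cycleGraph (m + 4)).Adj (i + 1) (i + 1 + 1) := fun i => e1 _
  have hne : ∀ i : Fin (m + 4), i ≠ i + 1 + 1 := fun i h => by
    have h' : (1 + 1 : Fin (m + 4)) = 0 := by
      rw [add_assoc] at h; exact left_eq_add.mp h
    have := congrArg Fin.val h'
    simp only [Fin.val_add, Fin.val_one, Fin.val_zero] at this
    rw [Nat.mod_eq_of_lt (by omega)] at this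
    omega
  have hna : ∀ i : Fin (m + 4), ¬ (cycleGraph (m + 4)).Adj i (i + 1 + 1) := fun i h => by
    rw [cycleGraph_adj] at h
    rcases h with h | h
    · have h' : (1 + 1 + 1 : Fin (m + 4)) = 0 := by
        have : i - (i + 1 + 1) + (1 + 1) = 0 := by abel
        rw [h] at this
        rw [← this]; abel
      have := congrArg Fin.val h'
      simp only [Fin.val_add, Fin.val_one, Fin.val_zero, Nat.mod_add_mod] at this
      rw [Nat.mod_eq_of_lt (by omega)] at this
      omega
    · have h' : (1 : Fin (m + 4)) = 0 := by
        have : i + 1 + 1 - i = 1 + 1 := by abel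
        rw [h] at this
        exact left_eq_add.mp this
      have := congrArg Fin.val h'
      simp at this
  have hK : ∀ i : Fin (m + 4), K (f (i + 1)) := by
    intro i
    by_contra hn
    have := hsimp _ (f i) (f (i + 1 + 1)) hn (f.map_adj_iff.mpr (e1 i).symm)
      (f.map_adj_iff.mpr (e2 i)) (fun h => hne i (f.injective h))
    exact hna i (f.map_adj_iff.mp this)
  have := htrans _ _ _ (hK 0) (hK (0 + 1)) (hK (0 + 1 + 1)) (f.map_adj_iff.mpr (e2 0))
    (f.map_adj_iff.mpr (e2 (0 + 1))) (fun h => hne _ (f.injective h))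
  exact hna _ (f.map_adj_iff.mp this)

theorem IsBipartite.no_triangle {V : Type*} {G : SimpleGraph V} (h : G.IsBipartite) {a b c : V}
    (hab : G.Adj a b) (hbc : G.Adj b c) (hac : G.Adj a c) : False := by
  obtain ⟨f⟩ := h
  have h1 := f.valid hab
  have h2 := f.valid hbc
  have h3 := f.valid hac
  revert h1 h2 h3
  generalize f a = x
  generalize f b = y
  generalize f c = z
  revert x y z
  decide

end SimpleGraph

/-! ### The gadget graph -/

/-- The vertices of the gadget graph: the modulator `S`, and for each gadget `γ : Γ` its slots
`w : W`, two apices, and a pendant vertex for every slot and every vertex of the modulator. -/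
abbrev GadgetVertex (S Γ W : Type*) := S ⊕ (Γ × (W ⊕ (Fin 2 ⊕ (W × S))))

namespace Gadget

variable {S Γ W : Type*}

/-- The edges of the gadget graph, each in one direction: the slots of a gadget form a clique, its
apices are joined to all its slots, and for a slot `w` that requires the deletion of `x ∈ S`
(`A γ w x`) the slot, its pendant vertex and `x` form a triangle.  Pendant vertices are joined to
their slot in any case. -/
def edge (A : Γ → W → S → Prop) : GadgetVertex S Γ W → GadgetVertex S Γ W → Prop
  | .inr (γ, .inl w), .inr (γ', .inl w') => γ = γ' ∧ w ≠ w'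
  | .inr (γ, .inl _), .inr (γ', .inr (.inl _)) => γ = γ'
  | .inr (γ, .inl w), .inr (γ', .inr (.inr (w', _))) => γ = γ' ∧ w = w'
  | .inr (γ, .inl w), .inl x => A γ w x
  | .inr (γ, .inr (.inr (w, x))), .inl x' => x = x' ∧ A γ w x
  | _, _ => False

/-- The gadget graph. -/
def graph (A : Γ → W → S → Prop) : SimpleGraph (GadgetVertex S Γ W) where
  Adj u v := edge A u v ∨ edge A v u
  symm := ⟨fun _ _ h => h.symm⟩
  loopless := ⟨by
    rintro (x | ⟨γ, w | i | ⟨w, x⟩⟩) (h | h) <;> simp [edge] at h⟩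

/-- The gadget graph without its modulator is chordal: every vertex but the slots is simplicial. -/
theorem chordal (A : Γ → W → S → Prop) (X : Finset (GadgetVertex S Γ W))
    (hX : ∀ x, Sum.inl x ∈ X) : (graph A).IsCVD X := by
  refine SimpleGraph.isChordal_of_simplicial _
    (fun u => ∃ γ w, (u : GadgetVertex S Γ W) = .inr (γ, .inl w)) ?_ ?_
  · rintro ⟨u, hu⟩ ⟨a, ha⟩ ⟨b, hb⟩ hK h1 h2 hab
    simp only [SimpleGraph.comap_adj, Function.Embedding.subtype_apply, graph, ne_eq,
      Subtype.mk.injEq] at *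
    rcases u with x | ⟨γ, w | i | ⟨w, x⟩⟩ <;>
    rcases a with x' | ⟨γ', w' | i' | ⟨w', x'⟩⟩ <;>
    rcases b with x'' | ⟨γ'', w'' | i'' | ⟨w'', x''⟩⟩ <;>
    simp_all [edge]
  · rintro ⟨u, hu⟩ ⟨a, ha⟩ ⟨b, hb⟩ ⟨γ, w, rfl⟩ ⟨γ', w', rfl⟩ ⟨γ'', w'', rfl⟩ h1 h2 hab
    simp only [SimpleGraph.comap_adj, Function.Embedding.subtype_apply, graph, edge, ne_eq,
      Subtype.mk.injEq] at *
    grind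

/-- If every gadget has a slot whose requirement is met by `Y`, then deleting `Y` and all but one
slot of every gadget leaves a forest, in fact a disjoint union of stars centred at slots and at
vertices of the modulator. -/
theorem exists_deletion [Fintype Γ] [Fintype W] (A : Γ → W → S → Prop)
    (Y : Finset S) (hY : ∀ γ, ∃ w, ∀ x, A γ w x → x ∈ Y) :
    ∃ X : Finset (GadgetVertex S Γ W),
      X.card ≤ Y.card + Fintype.card Γ * (Fintype.card W - 1) ∧ ((graph A).minus X).IsAcyclic := by
  classical
  choose σ hσ using hY
  refine ⟨Y.disjSum (Finset.univ.biUnion fun γ =>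
    (Finset.univ.erase (σ γ)).image fun w => (γ, .inl w)), ?_, ?_⟩
  · rw [Finset.card_disjSum]
    refine Nat.add_le_add_left (Finset.card_biUnion_le_card_mul _ _ _ fun γ _ => ?_) _
    refine Finset.card_image_le.trans ?_
    rw [Finset.card_erase_of_mem (Finset.mem_univ _), Finset.card_univ]
  · refine SimpleGraph.isAcyclic_of_leaves _
      (fun u => ∃ γ r, (u : GadgetVertex S Γ W) = .inr (γ, .inr r)) ?_ ?_
    · rintro ⟨u, hu⟩ ⟨a, ha⟩ h
      simp only [SimpleGraph.comap_adj, Function.Embedding.subtype_apply, graph] at h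
      rw [Set.mem_compl_iff, Finset.mem_coe] at hu ha
      rcases u with x | ⟨γ, w | r⟩ <;> rcases a with x' | ⟨γ', w' | r'⟩ <;>
        simp_all [edge] <;> grind
    · rintro ⟨u, hu⟩ ⟨a, ha⟩ ⟨b, hb⟩ ⟨γ, r, rfl⟩ h1 h2
      simp only [SimpleGraph.comap_adj, Function.Embedding.subtype_apply, graph] at h1 h2
      simp only [Subtype.mk.injEq]
      rw [Set.mem_compl_iff, Finset.mem_coe] at hu ha hb
      rcases r with i | ⟨w, x⟩ <;>
      rcases a with x' | ⟨γ', w' | i' | ⟨w', x'⟩⟩ <;>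
      rcases b with x'' | ⟨γ'', w'' | i'' | ⟨w'', x''⟩⟩ <;>
      simp_all [edge] <;> grind

/-- `X` meets every triangle. -/
def HitsTriangles {V : Type*} (G : SimpleGraph V) (X : Finset V) : Prop :=
  ∀ a b c, G.Adj a b → G.Adj b c → G.Adj a c → a ∈ X ∨ b ∈ X ∨ c ∈ X

section lower

variable [Fintype W] [Fintype S]
  (A : Γ → W → S → Prop) (X : Finset (GadgetVertex S Γ W)) (γ : Γ)

open Classical in
/-- The private vertices of the gadget `γ` that belong to `X`. -/
noncomputable def part : Finset (W ⊕ (Fin 2 ⊕ (W × S))) :=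
  Finset.univ.filter fun r => Sum.inr (γ, r) ∈ X

/-- If two slots of a gadget are left, then both apices and all other slots belong to `X`, so the
gadget costs one more than necessary. -/
theorem le_card_part_of_two (hX : HitsTriangles (graph A) X) {w w' : W} (hne : w ≠ w')
    (hw : Sum.inr (γ, .inl w) ∉ X) (hw' : Sum.inr (γ, .inl w') ∉ X) :
    Fintype.card W ≤ (part X γ).card := by
  classical
  have hap : ∀ i, Sum.inr (γ, .inr (.inl i)) ∈ X := fun i => by
    have := hX (.inr (γ, .inl w)) (.inr (γ, .inl w')) (.inr (γ, .inr (.inl i)))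
      (by simp [graph, edge, hne]) (by simp [graph, edge]) (by simp [graph, edge])
    tauto
  have hsl : ∀ v, v ≠ w → v ≠ w' → Sum.inr (γ, .inl v) ∈ X := fun v h1 h2 => by
    have := hX (.inr (γ, .inl w)) (.inr (γ, .inl w')) (.inr (γ, .inl v))
      (by simp [graph, edge, hne]) (by simp [graph, edge, h2.symm]) (by simp [graph, edge, h1.symm])
    tauto
  have hsub : ((Finset.univ.erase w).erase w').disjSum
      ((Finset.univ : Finset (Fin 2)).disjSum (∅ : Finset (W × S))) ⊆ part X γ := by
    rintro (v | i | p) h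
    · simp at h
      simpa [part] using hsl v h.2 h.1
    · simpa [part] using hap i
    · simp at h
  -- `|W| - 2` slots and two apices
  have := Finset.card_le_card hsub
  rw [Finset.card_disjSum, Finset.card_disjSum, Finset.card_erase_of_mem (by simp [hne.symm]),
    Finset.card_erase_of_mem (by simp)] at this
  simp at this
  omega

/-- A set that meets all triangles has at least `|W| - 1` private vertices of each gadget. -/
theorem card_le_part_add_one (hX : HitsTriangles (graph A) X) :
    Fintype.card W ≤ (part X γ).card + 1 := by
  classical
  by_contra! hlt
  have hsub : (Finset.univ.filter fun w => Sum.inr (γ, .inl w) ∈ X).disjSum ∅ ⊆ part X γ := by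
    rintro (v | r) h
    · simpa [part] using h
    · simp at h
  have h1 := Finset.card_le_card hsub
  have h2 := Finset.card_filter_add_card_filter_not (s := (Finset.univ : Finset W))
    (fun w => Sum.inr (γ, .inl w) ∈ X)
  rw [Finset.card_disjSum, Finset.card_empty] at h1
  rw [Finset.card_univ] at h2
  obtain ⟨w, hw, w', hw', hne⟩ := Finset.one_lt_card.mp
    (show 1 < (Finset.univ.filter fun w => ¬ Sum.inr (γ, .inl w) ∈ X).card by omega)
  have := le_card_part_of_two A X γ hX hne (by simpa using hw) (by simpa using hw')
  omega

/-- If a set that meets all triangles is as small as possible on a gadget, then it meets the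
requirement of the slot that it leaves. -/
theorem exists_slot_of_part_lt (hX : HitsTriangles (graph A) X)
    (hlt : (part X γ).card < Fintype.card W) : ∃ w, ∀ x, A γ w x → Sum.inl x ∈ X := by
  classical
  have hsub : (Finset.univ.filter fun w => Sum.inr (γ, .inl w) ∈ X).disjSum ∅ ⊆ part X γ := by
    rintro (v | r) h
    · simpa [part] using h
    · simp at h
  obtain ⟨w, hw⟩ : ∃ w, Sum.inr (γ, .inl w) ∉ X := by
    by_contra! hall
    have h1 := Finset.card_le_card hsub
    simp [hall] at h1
    omega
  refine ⟨w, fun x hx => ?_⟩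
  by_contra hxX
  have hp : Sum.inr (γ, .inr (.inr (w, x))) ∈ X := by
    have := hX (.inr (γ, .inl w)) (.inr (γ, .inr (.inr (w, x)))) (.inl x)
      (by simp [graph, edge]) (by simp [graph, edge, hx]) (by simp [graph, edge, hx])
    tauto
  have hone : ∀ v, v ≠ w → Sum.inr (γ, .inl v) ∈ X := fun v hv => by
    by_contra hvX
    have := le_card_part_of_two A X γ hX hv hvX hw
    omega
  have hsub : (Finset.univ.erase w).disjSum
      ((∅ : Finset (Fin 2)).disjSum {(w, x)}) ⊆ part X γ := by
    rintro (v | i | p) h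
    · simp at h
      simpa [part] using hone v h
    · simp at h
    · simp at h
      simpa [part, h] using hp
  have := Finset.card_le_card hsub
  rw [Finset.card_disjSum, Finset.card_disjSum, Finset.card_erase_of_mem (by simp)] at this
  simp at this
  omega

end lower

/-- With more copies of each gadget than the budget `β` of the modulator, a small set that meets
all triangles is as small as possible on one copy of every gadget, and so its part in the modulator
meets the requirement of a slot of every gadget. -/
theorem exists_cover {C K : Type*} [Fintype C] [Fintype K] [Fintype W] [Nonempty W]
    [Fintype S] (A : C → W → S → Prop) (β : ℕ) (hβ : β < Fintype.card K)
    (X : Finset (GadgetVertex S (C × K) W))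
    (hX : HitsTriangles (graph fun γ => A γ.1) X)
    (hcard : X.card ≤ β + Fintype.card (C × K) * (Fintype.card W - 1)) :
    ∃ Y : Finset S, Y.card ≤ β ∧ ∀ c, ∃ w, ∀ x, A c w x → x ∈ Y := by
  classical
  have hsum : X.card = X.toLeft.card + ∑ γ, (part X γ).card := by
    rw [← Finset.card_toLeft_add_card_toRight]
    congr 1
    rw [Finset.card_eq_sum_card_fiberwise (f := Prod.fst) (t := Finset.univ) (by simp [Set.MapsTo])]
    refine Finset.sum_congr rfl fun γ _ => ?_
    refine Finset.card_nbij' (fun p => p.2) (fun r => (γ, r)) ?_ ?_ ?_ ?_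
    · rintro ⟨γ', r⟩ h
      simp at h
      simp [part, ← h.2, h.1]
    · intro r h
      simpa [part] using h
    · rintro ⟨γ', r⟩ h
      simp at h
      simp [h.2]
    · intro r h
      rfl
  have hlow : ∀ γ, Fintype.card W - 1 ≤ (part X γ).card := fun γ => by
    have := card_le_part_add_one _ X γ hX
    omega
  have hlow' : Fintype.card (C × K) * (Fintype.card W - 1) ≤ ∑ γ, (part X γ).card := by
    rw [← Finset.card_univ, ← smul_eq_mul]
    exact Finset.card_nsmul_le_sum _ _ _ fun γ _ => hlow γ
  refine ⟨X.toLeft, by omega, fun c => ?_⟩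
  by_contra! hc
  -- otherwise every copy of the gadget `c` costs one more than necessary, which exceeds `β`
  have hbig : ∀ i : K, Fintype.card W ≤ (part X (c, i)).card := fun i => by
    by_contra! hlt
    obtain ⟨w, hw⟩ := exists_slot_of_part_lt _ X (c, i) hX hlt
    obtain ⟨x, hx, hx'⟩ := hc w
    exact hx' (by simpa using hw x hx)
  have hsum2 : Fintype.card (C × K) * (Fintype.card W - 1) + Fintype.card K ≤
      ∑ γ, (part X γ).card := by
    have h1 : ∀ γ : C × K, (Fintype.card W - 1) + (if γ.1 = c then 1 else 0) ≤
        (part X γ).card := fun γ => by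
      split_ifs with h
      · obtain ⟨c', i⟩ := γ
        obtain rfl : c' = c := h
        have := hbig i
        have := Fintype.card_pos (α := W)
        omega
      · exact hlow γ
    have h2 : Fintype.card K = ∑ γ : C × K, if γ.1 = c then 1 else 0 := by
      rw [Fintype.sum_prod_type_right]
      simp
    rw [h2, ← Finset.card_univ, ← smul_eq_mul, ← Finset.sum_const, ← Finset.sum_add_distrib]
    exact Finset.sum_le_sum fun γ _ => h1 γ
  omega

end Gadget

/-! ### Running machine programs with an upper bound on the time -/

namespace RAM

theorem size_le_self (n : ℕ) : n.size ≤ n := by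
  rcases Nat.eq_zero_or_pos n with rfl | h
  · simp
  · exact Nat.size_le.mpr n.lt_two_pow_self

/-- The program `p`, started in `s`, halts in `s'` within time `T`. -/
def Run (p : Prog) (s : State) (T : ℕ) (s' : State) : Prop :=
  ∃ t ≤ T, Exec p s t s'

namespace Run

variable {p q : Prog} {s s' s'' : State} {T T' : ℕ}

theorem mono (h : Run p s T s') (hT : T ≤ T') : Run p s T' s' :=
  let ⟨t, ht, he⟩ := h
  ⟨t, ht.trans hT, he⟩

theorem const (s : State) (i c : ℕ) : Run (.const i c) s (1 + c) (s.setReg i c) :=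
  ⟨_, Nat.add_le_add_left (size_le_self c) 1, .const s i c⟩

theorem add (s : State) (i j k : ℕ) :
    Run (.add i j k) s (1 + s.reg j + s.reg k) (s.setReg i (s.reg j + s.reg k)) :=
  ⟨_, Nat.add_le_add (Nat.add_le_add_left (size_le_self _) 1) (size_le_self _), .add s i j k⟩

theorem sub (s : State) (i j k : ℕ) :
    Run (.sub i j k) s (1 + s.reg j + s.reg k) (s.setReg i (s.reg j - s.reg k)) :=
  ⟨_, Nat.add_le_add (Nat.add_le_add_left (size_le_self _) 1) (size_le_self _), .sub s i j k⟩

theorem load (s : State) (i a j : ℕ) :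
    Run (.load i a j) s (1 + s.reg j + s.arr a (s.reg j)) (s.setReg i (s.arr a (s.reg j))) :=
  ⟨_, Nat.add_le_add (Nat.add_le_add_left (size_le_self _) 1) (size_le_self _), .load s i a j⟩

theorem store (s : State) (a i j : ℕ) :
    Run (.store a i j) s (1 + s.reg i + s.reg j) (s.setArr a (s.reg i) (s.reg j)) :=
  ⟨_, Nat.add_le_add (Nat.add_le_add_left (size_le_self _) 1) (size_le_self _), .store s a i j⟩

theorem seq (h : Run p s T s') (h' : Run q s' T' s'') : Run (.seq p q) s (T + T') s'' :=
  let ⟨_, ht, he⟩ := h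
  let ⟨_, ht', he'⟩ := h'
  ⟨_, Nat.add_le_add ht ht', .seq he he'⟩

theorem cond_true {i : ℕ} (hi : s.reg i ≠ 0) (h : Run p s T s') :
    Run (.cond i p q) s (1 + s.reg i + T) s' :=
  let ⟨_, ht, he⟩ := h
  ⟨_, Nat.add_le_add (Nat.add_le_add_left (size_le_self _) 1) ht, .cond_true hi he⟩

theorem cond_false {i : ℕ} (hi : s.reg i = 0) (h : Run q s T s') :
    Run (.cond i p q) s (1 + T) s' :=
  let ⟨_, ht, he⟩ := h
  ⟨_, Nat.add_le_add_left ht 1, .cond_false hi he⟩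

theorem loop_true {i : ℕ} (hi : s.reg i ≠ 0) (h : Run p s T s')
    (h' : Run (.loop i p) s' T' s'') : Run (.loop i p) s (1 + s.reg i + T + T') s'' :=
  let ⟨_, ht, he⟩ := h
  let ⟨_, ht', he'⟩ := h'
  ⟨_, Nat.add_le_add (Nat.add_le_add (Nat.add_le_add_left (size_le_self _) 1) ht) ht',
    .loop_true hi he he'⟩

theorem loop_false {i : ℕ} (hi : s.reg i = 0) : Run (.loop i p) s 1 s :=
  ⟨1, le_rfl, .loop_false hi⟩

end Run

@[simp] theorem State.reg_setReg (s : State) (i v j : ℕ) :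
    (s.setReg i v).reg j = if j = i then v else s.reg j := by
  simp [State.setReg, Function.update_apply]

@[simp] theorem State.arr_setReg (s : State) (i v : ℕ) : (s.setReg i v).arr = s.arr := rfl

@[simp] theorem State.reg_setArr (s : State) (a i v : ℕ) : (s.setArr a i v).reg = s.reg := rfl

theorem State.arr_setArr (s : State) (a i v b j : ℕ) :
    (s.setArr a i v).arr b j = if b = a ∧ j = i then v else s.arr b j := by
  simp only [State.setArr, Function.update_apply]
  split_ifs <;> simp_all

/-- `s'` has the same arrays as `s` and the same registers below `d`. -/
structure Frame (d : ℕ) (s s' : State) : Prop where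
  reg : ∀ i < d, s'.reg i = s.reg i
  arr : s'.arr = s.arr

namespace Frame

variable {d d' : ℕ} {s s' s'' : State}

theorem trans (h : Frame d s s') (h' : Frame d s' s'') : Frame d s s'' :=
  ⟨fun i hi => (h'.reg i hi).trans (h.reg i hi), h'.arr.trans h.arr⟩

theorem mono (h : Frame d s s') (hd : d' ≤ d) : Frame d' s s' :=
  ⟨fun i hi => h.reg i (hi.trans_le hd), h.arr⟩

theorem setReg {i v : ℕ} (h : Frame d s s') (hi : d ≤ i) : Frame d s (s'.setReg i v) :=
  ⟨fun j hj => by simp [(hj.trans_le hi).ne, h.reg j hj], h.arr⟩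

theorem refl (d : ℕ) (s : State) : Frame d s s := ⟨fun _ _ => rfl, rfl⟩

end Frame

/-! ### Multiplication, division and tables -/

/-- `R d := R d * R (d + 1)`, by repeated addition. -/
def mulProg (d : ℕ) : Prog :=
  .seq (.const (d + 2) 0) <| .seq
    (.loop (d + 1) <| .seq (.add (d + 2) (d + 2) d) <|
      .seq (.const (d + 3) 1) (.sub (d + 1) (d + 1) (d + 3)))
    (.seq (.const d 0) (.add d d (d + 2)))

/-- A time bound for `mulProg` on the factors `x` and `y`. -/
def mulTime (x y : ℕ) : ℕ := y * (10 + 2 * y + x * y + x) + x * y + 10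

theorem mulTime_mono {x x' y y' : ℕ} (hx : x ≤ x') (hy : y ≤ y') :
    mulTime x y ≤ mulTime x' y' := by
  unfold mulTime; gcongr

theorem run_mulLoop (d Y Z y : ℕ) (s : State) (hy : s.reg (d + 1) = y) (hY : y ≤ Y)
    (hZ : s.reg (d + 2) + s.reg d * y ≤ Z) :
    ∃ s', Run (.loop (d + 1) <| .seq (.add (d + 2) (d + 2) d) <|
      .seq (.const (d + 3) 1) (.sub (d + 1) (d + 1) (d + 3))) s
        (y * (10 + 2 * Y + Z + s.reg d) + 1) s' ∧
      s'.reg (d + 2) = s.reg (d + 2) + s.reg d * y ∧ Frame (d + 1) s s' := by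
  induction y generalizing s with
  | zero => exact ⟨s, (Run.loop_false hy).mono (by omega), by simp, .refl _ _⟩
  | succ y ih =>
    have r1 := Run.add s (d + 2) (d + 2) d
    set s1 := s.setReg (d + 2) (s.reg (d + 2) + s.reg d) with hs1
    have r2 := Run.const s1 (d + 3) 1
    set s2 := s1.setReg (d + 3) 1 with hs2
    have r3 := Run.sub s2 (d + 1) (d + 1) (d + 3)
    set s3 := s2.setReg (d + 1) (s2.reg (d + 1) - s2.reg (d + 3)) with hs3
    have e1 : s3.reg (d + 1) = y := by simp [s3, s2, s1, hy]
    have e2 : s3.reg d = s.reg d := by simp [s3, s2, s1]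
    have e3 : s3.reg (d + 2) = s.reg (d + 2) + s.reg d := by simp [s3, s2, s1]
    have e4 : s2.reg (d + 1) = y + 1 := by simp [s2, s1, hy]
    have e5 : s2.reg (d + 3) = 1 := by simp [s2]
    have hf : Frame (d + 1) s s3 :=
      (((Frame.refl _ _).setReg (by omega)).setReg (by omega)).setReg (by omega)
    have hZ' : s.reg (d + 2) + s.reg d + s.reg d * y ≤ Z := by
      rw [mul_add] at hZ; omega
    obtain ⟨s', hr, hv, hf'⟩ := ih s3 e1 (by omega) (by rw [e2, e3]; exact hZ')
    refine ⟨s', (Run.loop_true (by omega) (r1.seq (r2.seq r3)) hr).mono ?_, ?_, hf.trans hf'⟩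
    · rw [e2, e4, e5, hy, add_mul]
      generalize s.reg d * y = w at *
      generalize y * (10 + 2 * Y + Z + s.reg d) = w' at *
      omega
    · rw [hv, e2, e3]; ring

theorem run_mulProg (d : ℕ) (s : State) :
    ∃ s', Run (mulProg d) s (mulTime (s.reg d) (s.reg (d + 1))) s' ∧
      s'.reg d = s.reg d * s.reg (d + 1) ∧ Frame d s s' := by
  have r1 := Run.const s (d + 2) 0
  set s1 := s.setReg (d + 2) 0 with hs1
  have e1 : s1.reg (d + 1) = s.reg (d + 1) := by simp [s1]
  have e2 : s1.reg d = s.reg d := by simp [s1]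
  have e3 : s1.reg (d + 2) = 0 := by simp [s1]
  obtain ⟨s2, r2, hv, hf⟩ := run_mulLoop d (s.reg (d + 1)) (s.reg d * s.reg (d + 1)) _ s1 e1 le_rfl
    (by rw [e2, e3]; omega)
  have r3 := Run.const s2 d 0
  have r4 := Run.add (s2.setReg d 0) d d (d + 2)
  refine ⟨_, (r1.seq (r2.seq (r3.seq r4))).mono ?_, ?_, ?_⟩
  · rw [e2]
    simp [hv, e2, e3, mulTime]
    omega
  · simp [hv, e2, e3]
  · have : Frame d s s1 := (Frame.refl _ _).setReg (by omega)
    exact ((this.trans (hf.mono (by omega))).setReg le_rfl).setReg le_rfl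

/-- `R d := R d / R (d + 1)`, by repeated subtraction; the quotient by zero is zero. -/
def divProg (d : ℕ) : Prog :=
  .cond (d + 1)
    (.seq (.const (d + 2) 0) <| .seq (.const (d + 3) 1) <|
      .seq (.add (d + 4) d (d + 3)) <| .seq (.sub (d + 4) (d + 4) (d + 1)) <| .seq
      (.loop (d + 4) <| .seq (.sub d d (d + 1)) <| .seq (.add (d + 2) (d + 2) (d + 3)) <|
        .seq (.add (d + 4) d (d + 3)) (.sub (d + 4) (d + 4) (d + 1)))
      (.seq (.const d 0) (.add d d (d + 2))))
    (.const d 0)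

/-- A time bound for `divProg` on the dividend `x` and the divisor `y`. -/
def divTime (x y : ℕ) : ℕ := (x + 1) * (20 + 10 * x + 10 * y) + 20 + 10 * x + 10 * y

theorem divTime_mono {x x' y y' : ℕ} (hx : x ≤ x') (hy : y ≤ y') :
    divTime x y ≤ divTime x' y' := by
  unfold divTime; gcongr

theorem run_divLoop (d X y q n : ℕ) (s : State) (hy : s.reg (d + 1) = y) (hy0 : 0 < y)
    (h1 : s.reg (d + 3) = 1) (ht : s.reg (d + 4) = s.reg d + 1 - y) (hq : s.reg d / y = q)
    (hn : s.reg (d + 2) = n) (hX : s.reg d + n ≤ X) :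
    ∃ s', Run (.loop (d + 4) <| .seq (.sub d d (d + 1)) <|
        .seq (.add (d + 2) (d + 2) (d + 3)) <|
        .seq (.add (d + 4) d (d + 3)) (.sub (d + 4) (d + 4) (d + 1))) s
        (q * (10 + 10 * X + 10 * y) + 1) s' ∧
      s'.reg (d + 2) = n + q ∧ Frame d s s' := by
  induction q generalizing s n with
  | zero =>
    have : s.reg d < y := (Nat.div_eq_zero_iff_lt hy0).mp hq
    exact ⟨s, (Run.loop_false (by omega)).mono (by omega), by simp [hn], .refl _ _⟩
  | succ q ih =>
    have hle : y ≤ s.reg d := by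
      by_contra! hlt
      rw [Nat.div_eq_of_lt hlt] at hq
      omega
    have hq' : (s.reg d - y) / y = q := by
      have := Nat.div_eq_sub_div hy0 hle
      omega
    have r1 := Run.sub s d d (d + 1)
    set s1 := s.setReg d (s.reg d - s.reg (d + 1)) with hs1
    have r2 := Run.add s1 (d + 2) (d + 2) (d + 3)
    set s2 := s1.setReg (d + 2) (s1.reg (d + 2) + s1.reg (d + 3)) with hs2
    have r3 := Run.add s2 (d + 4) d (d + 3)
    set s3 := s2.setReg (d + 4) (s2.reg d + s2.reg (d + 3)) with hs3
    have r4 := Run.sub s3 (d + 4) (d + 4) (d + 1)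
    set s4 := s3.setReg (d + 4) (s3.reg (d + 4) - s3.reg (d + 1)) with hs4
    have a1 : s1.reg (d + 2) = n := by simp [s1, hn]
    have a2 : s1.reg (d + 3) = 1 := by simp [s1, h1]
    have a3 : s2.reg d = s.reg d - y := by simp [s2, s1, hy]
    have a4 : s2.reg (d + 3) = 1 := by simp [s2, a2]
    have a5 : s3.reg (d + 4) = s.reg d - y + 1 := by simp [s3, a3, a4]
    have a6 : s3.reg (d + 1) = y := by simp [s3, s2, s1, hy]
    have e1 : s4.reg (d + 1) = y := by simp [s4, a6]
    have e2 : s4.reg (d + 3) = 1 := by simp [s4, s3, a4]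
    have e3 : s4.reg d = s.reg d - y := by simp [s4, s3, a3]
    have e4 : s4.reg (d + 4) = s4.reg d + 1 - y := by rw [e3]; simp [s4, a5, a6]
    have e5 : s4.reg (d + 2) = n + 1 := by simp [s4, s3, s2, a1, a2]
    have hf : Frame d s s4 := ((((Frame.refl _ _).setReg (by omega)).setReg (by omega)).setReg
      (by omega)).setReg (by omega)
    obtain ⟨s', hr, hv, hf'⟩ := ih (n + 1) s4 e1 e2 e4 (by rw [e3, hq']) e5 (by omega)
    refine ⟨s', (Run.loop_true (by omega) (r1.seq (r2.seq (r3.seq r4))) hr).mono ?_, ?_,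
      hf.trans hf'⟩
    · rw [ht, hy, a1, a2, a3, a4, a5, a6, add_mul]
      omega
    · omega

theorem run_divProg (d : ℕ) (s : State) :
    ∃ s', Run (divProg d) s (divTime (s.reg d) (s.reg (d + 1))) s' ∧
      s'.reg d = s.reg d / s.reg (d + 1) ∧ Frame d s s' := by
  obtain hy | hy := Nat.eq_zero_or_pos (s.reg (d + 1))
  · refine ⟨_, (Run.cond_false hy (Run.const s d 0)).mono ?_, ?_, (Frame.refl _ _).setReg le_rfl⟩
    · unfold divTime; omega
    · simp [hy]
  · have r1 := Run.const s (d + 2) 0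
    set s1 := s.setReg (d + 2) 0 with hs1
    have r2 := Run.const s1 (d + 3) 1
    set s2 := s1.setReg (d + 3) 1 with hs2
    have r3 := Run.add s2 (d + 4) d (d + 3)
    set s3 := s2.setReg (d + 4) (s2.reg d + s2.reg (d + 3)) with hs3
    have r4 := Run.sub s3 (d + 4) (d + 4) (d + 1)
    set s4 := s3.setReg (d + 4) (s3.reg (d + 4) - s3.reg (d + 1)) with hs4
    have a3 : s2.reg d = s.reg d := by simp [s2, s1]
    have a4 : s2.reg (d + 3) = 1 := by simp [s2]
    have a5 : s3.reg (d + 4) = s.reg d + 1 := by simp [s3, a3, a4]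
    have a6 : s3.reg (d + 1) = s.reg (d + 1) := by simp [s3, s2, s1]
    have e1 : s4.reg (d + 1) = s.reg (d + 1) := by simp [s4, a6]
    have e2 : s4.reg (d + 3) = 1 := by simp [s4, s3, a4]
    have e3 : s4.reg d = s.reg d := by simp [s4, s3, a3]
    have e4 : s4.reg (d + 4) = s4.reg d + 1 - s.reg (d + 1) := by rw [e3]; simp [s4, a5, a6]
    have e5 : s4.reg (d + 2) = 0 := by simp [s4, s3, s2, s1]
    have hf : Frame d s s4 := ((((Frame.refl _ _).setReg (by omega)).setReg (by omega)).setReg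
      (by omega)).setReg (by omega)
    obtain ⟨s5, r5, hv, hf'⟩ := run_divLoop d (s.reg d) (s.reg (d + 1)) (s.reg d / s.reg (d + 1))
      0 s4 e1 hy e2 e4 (by rw [e3]) e5 (by omega)
    have r6 := Run.const s5 d 0
    have r7 := Run.add (s5.setReg d 0) d d (d + 2)
    refine ⟨_, (Run.cond_true (by omega)
      (r1.seq (r2.seq (r3.seq (r4.seq (r5.seq (r6.seq r7))))))).mono ?_, ?_, ?_⟩
    · have hdiv : s.reg d / s.reg (d + 1) ≤ s.reg d := Nat.div_le_self _ _
      rw [a3, a4, a5, a6]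
      simp only [State.reg_setReg, hv, if_true, divTime]
      have : s.reg d / s.reg (d + 1) * (10 + 10 * s.reg d + 10 * s.reg (d + 1)) ≤
        s.reg d * (20 + 10 * s.reg d + 10 * s.reg (d + 1)) := by gcongr; omega
      rw [if_neg (by omega), add_mul]
      omega
    · simp [hv]
    · exact ((hf.trans hf').setReg le_rfl).setReg le_rfl

/-- `R d := l.getD (R d) 0`. -/
def tblProg (d : ℕ) : List ℕ → Prog
  | [] => .const d 0
  | a :: l => .cond d (.seq (.const (d + 1) 1) (.seq (.sub d d (d + 1)) (tblProg d l))) (.const d a)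

/-- A time bound for `tblProg` on the argument `x`. -/
def tblTime (l : List ℕ) (x : ℕ) : ℕ := l.length * (6 + 2 * x) + l.sum + 2

theorem run_tblProg (d : ℕ) (l : List ℕ) (s : State) :
    ∃ s', Run (tblProg d l) s (tblTime l (s.reg d)) s' ∧
      s'.reg d = l.getD (s.reg d) 0 ∧ Frame d s s' := by
  induction l generalizing s with
  | nil =>
    exact ⟨_, (Run.const s d 0).mono (by simp [tblTime]), by simp,
      (Frame.refl _ _).setReg le_rfl⟩
  | cons a l ih =>
    obtain h0 | h0 := Nat.eq_zero_or_pos (s.reg d)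
    · refine ⟨_, (Run.cond_false h0 (Run.const s d a)).mono ?_, by simp [h0],
        (Frame.refl _ _).setReg le_rfl⟩
      simp [tblTime]; omega
    · have r1 := Run.const s (d + 1) 1
      set s1 := s.setReg (d + 1) 1 with hs1
      have r2 := Run.sub s1 d d (d + 1)
      set s2 := s1.setReg d (s1.reg d - s1.reg (d + 1)) with hs2
      have a1 : s1.reg d = s.reg d := by simp [s1]
      have a2 : s1.reg (d + 1) = 1 := by simp [s1]
      have a3 : s2.reg d = s.reg d - 1 := by simp [s2, a1, a2]
      have hf : Frame d s s2 := ((Frame.refl _ _).setReg (by omega)).setReg (by omega)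
      obtain ⟨s', r3, hv, hf'⟩ := ih s2
      refine ⟨s', (Run.cond_true (by omega) (r1.seq (r2.seq r3))).mono ?_, ?_, hf.trans hf'⟩
      · rw [a1, a2, a3]
        have : l.length * (6 + 2 * (s.reg d - 1)) ≤ l.length * (6 + 2 * s.reg d) := by
          gcongr; omega
        simp only [tblTime, List.length_cons, List.sum_cons, add_mul, one_mul]
        omega
      · rw [hv, a3]
        obtain ⟨n, hn⟩ := Nat.exists_eq_succ_of_ne_zero h0.ne'
        simp [hn]

end RAM

/-! ### A language with arithmetic expressions and its compiler -/

namespace RAM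

/-- Expressions over the registers and arrays of a configuration. -/
inductive Expr where
  | const (c : ℕ)
  | var (i : ℕ)
  | arr (a : ℕ) (e : Expr)
  | add (e f : Expr)
  | sub (e f : Expr)
  | mul (e f : Expr)
  | div (e f : Expr)
  /-- `if c ≠ 0 then e else f` -/
  | ite (c e f : Expr)
  /-- lookup in a fixed list, with default value zero -/
  | tbl (l : List ℕ) (e : Expr)

namespace Expr

/-- The value of an expression. -/
def eval (s : State) : Expr → ℕ
  | const c => c
  | var i => s.reg i
  | arr a e => s.arr a (e.eval s)
  | add e f => e.eval s + f.eval s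
  | sub e f => e.eval s - f.eval s
  | mul e f => e.eval s * f.eval s
  | div e f => e.eval s / f.eval s
  | ite c e f => if c.eval s ≠ 0 then e.eval s else f.eval s
  | tbl l e => l.getD (e.eval s) 0

/-- All registers in the expression are below `D`. -/
def VarsBelow (D : ℕ) : Expr → Prop
  | const _ => True
  | var i => i < D
  | arr _ e => e.VarsBelow D
  | add e f => e.VarsBelow D ∧ f.VarsBelow D
  | sub e f => e.VarsBelow D ∧ f.VarsBelow D
  | mul e f => e.VarsBelow D ∧ f.VarsBelow D
  | div e f => e.VarsBelow D ∧ f.VarsBelow D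
  | ite c e f => c.VarsBelow D ∧ e.VarsBelow D ∧ f.VarsBelow D
  | tbl _ e => e.VarsBelow D

/-- A bound for the value of the expression if all numbers in the memory are at most `B`. -/
def bound (B : ℕ) : Expr → ℕ
  | const c => c
  | var _ => B
  | arr _ _ => B
  | add e f => e.bound B + f.bound B
  | sub e _ => e.bound B
  | mul e f => e.bound B * f.bound B
  | div e _ => e.bound B
  | ite _ e f => e.bound B + f.bound B
  | tbl l _ => l.sum

/-- A bound for the time to compute the expression if all numbers in the memory are at most
`B`. -/
def time (B : ℕ) : Expr → ℕ
  | const c => 1 + c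
  | var _ => 2 + B
  | arr _ e => e.time B + (1 + e.bound B + B)
  | add e f => e.time B + (f.time B + (1 + e.bound B + f.bound B))
  | sub e f => e.time B + (f.time B + (1 + e.bound B + f.bound B))
  | mul e f => e.time B + (f.time B + mulTime (e.bound B) (f.bound B))
  | div e f => e.time B + (f.time B + divTime (e.bound B) (f.bound B))
  | ite c e f => c.time B + (1 + c.bound B + (e.time B + f.time B))
  | tbl l e => e.time B + tblTime l (e.bound B)

end Expr

/-- The register (or array) of the machine that stands for the register (or array) `i` of the
expression language: register and array `0` keep their places, and the others move beyond `N`, so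
that they leave room for a program that uses no others than `0, …, N`. -/
def ren (N i : ℕ) : ℕ := if i = 0 then 0 else N + i

theorem ren_zero (N : ℕ) : ren N 0 = 0 := rfl

theorem ren_injective (N : ℕ) : Function.Injective (ren N) := by
  intro i j h
  unfold ren at h
  split_ifs at h <;> omega

theorem ren_lt {N D i : ℕ} (hi : i < D) : ren N i < N + D := by
  unfold ren; split_ifs <;> omega

theorem ren_ne {N i j : ℕ} (hj : 1 ≤ j) (hjN : j ≤ N) : j ≠ ren N i := by
  unfold ren; split_ifs <;> omega

/-- The configuration `s'` of the machine represents the configuration `s` of the expression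
language with the registers `0, …, D - 1`. -/
structure Sim (N D : ℕ) (s s' : State) : Prop where
  reg : ∀ i < D, s'.reg (ren N i) = s.reg i
  arr : ∀ a, s'.arr (ren N a) = s.arr a
  reg_zero : ∀ i, 1 ≤ i → i ≤ N → s'.reg i = 0
  arr_zero : ∀ a, 1 ≤ a → a ≤ N → s'.arr a = fun _ => 0

theorem Sim.frame {N D d : ℕ} {s s' s'' : State} (h : Sim N D s s') (hd : N + D ≤ d) (hD : 0 < D)
    (hf : Frame d s' s'') : Sim N D s s'' where
  reg i hi := (hf.reg _ ((ren_lt hi).trans_le hd)).trans (h.reg i hi)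
  arr a := by rw [hf.arr, h.arr]
  reg_zero i hi hi' := (hf.reg _ (by omega)).trans (h.reg_zero i hi hi')
  arr_zero a ha ha' := by rw [hf.arr, h.arr_zero a ha ha']

/-- All numbers in the memory are at most `B`. -/
structure State.BddBy (D B : ℕ) (s : State) : Prop where
  reg : ∀ i < D, s.reg i ≤ B
  arr : ∀ a j, s.arr a j ≤ B

namespace Expr

theorem getD_le_sum (l : List ℕ) (i : ℕ) : l.getD i 0 ≤ l.sum := by
  rw [List.getD_eq_getElem?_getD]
  rcases h : l[i]? with _ | a
  · simp
  · exact List.le_sum_of_mem (List.mem_of_getElem? h)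

theorem eval_le {D B : ℕ} {s : State} (hB : s.BddBy D B) (e : Expr) (he : e.VarsBelow D) :
    e.eval s ≤ e.bound B := by
  induction e with
  | const c => exact le_rfl
  | var i => exact hB.reg i he
  | arr a e _ => exact hB.arr a _
  | add e f ihe ihf => exact Nat.add_le_add (ihe he.1) (ihf he.2)
  | sub e f ihe _ => exact (Nat.sub_le _ _).trans (ihe he.1)
  | mul e f ihe ihf => exact Nat.mul_le_mul (ihe he.1) (ihf he.2)
  | div e f ihe _ => exact (Nat.div_le_self _ _).trans (ihe he.1)
  | ite c e f _ ihe ihf =>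
    have h1 := ihe he.2.1
    have h2 := ihf he.2.2
    simp only [eval, bound]
    split_ifs <;> omega
  | tbl l e _ => exact getD_le_sum _ _

/-- The program that computes the expression into register `d`; the registers beyond `d` serve as
scratch space. -/
def compile (N : ℕ) : Expr → ℕ → Prog
  | const c, d => .const d c
  | var i, d => .seq (.const d 0) (.add d (ren N i) d)
  | arr a e, d => .seq (e.compile N d) (.load d (ren N a) d)
  | add e f, d => .seq (e.compile N d) (.seq (f.compile N (d + 1)) (.add d d (d + 1)))
  | sub e f, d => .seq (e.compile N d) (.seq (f.compile N (d + 1)) (.sub d d (d + 1)))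
  | mul e f, d => .seq (e.compile N d) (.seq (f.compile N (d + 1)) (mulProg d))
  | div e f, d => .seq (e.compile N d) (.seq (f.compile N (d + 1)) (divProg d))
  | ite c e f, d => .seq (c.compile N d) (.cond d (e.compile N d) (f.compile N d))
  | tbl l e, d => .seq (e.compile N d) (tblProg d l)

theorem run_compile {N D B : ℕ} (hD : 0 < D) {s : State} (hB : s.BddBy D B) (e : Expr)
    (he : e.VarsBelow D) (d : ℕ) (hd : N + D ≤ d) (s' : State) (hs : Sim N D s s') :
    ∃ s'', Run (e.compile N d) s' (e.time B) s'' ∧ s''.reg d = e.eval s ∧ Frame d s' s'' := by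
  induction e generalizing d s' with
  | const c =>
    exact ⟨_, Run.const _ _ _, by simp [eval], (Frame.refl _ _).setReg le_rfl⟩
  | var i =>
    have hlt : ren N i < d := (ren_lt he).trans_le hd
    have hi := hs.reg i he
    have hb := hB.reg i he
    refine ⟨_, ((Run.const s' d 0).seq (Run.add _ _ _ _)).mono ?_, ?_,
      ((Frame.refl _ _).setReg le_rfl).setReg le_rfl⟩
    · simp [time, hlt.ne, hi]; omega
    · simp [eval, hlt.ne, hi]
  | arr a e ih =>
    obtain ⟨s1, r1, hv, hf⟩ := ih he d hd s' hs
    have hb := eval_le hB e he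
    have hs1 := hs.frame hd hD hf
    refine ⟨_, (r1.seq (Run.load _ _ _ _)).mono ?_, ?_, hf.setReg le_rfl⟩
    · rw [hs1.arr, hv]
      have := hB.arr a (e.eval s)
      simp only [time]; omega
    · simp [eval, hs1.arr, hv]
  | add e f ihe ihf =>
    obtain ⟨s1, r1, hv, hf⟩ := ihe he.1 d hd s' hs
    obtain ⟨s2, r2, hv', hf'⟩ := ihf he.2 (d + 1) (by omega) s1 (hs.frame hd hD hf)
    have hv1 : s2.reg d = e.eval s := (hf'.reg d (by omega)).trans hv
    have := eval_le hB e he.1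
    have := eval_le hB f he.2
    refine ⟨_, (r1.seq (r2.seq (Run.add _ _ _ _))).mono ?_, ?_,
      (hf.trans (hf'.mono (by omega))).setReg le_rfl⟩
    · simp only [time]; omega
    · simp [eval, hv1, hv']
  | sub e f ihe ihf =>
    obtain ⟨s1, r1, hv, hf⟩ := ihe he.1 d hd s' hs
    obtain ⟨s2, r2, hv', hf'⟩ := ihf he.2 (d + 1) (by omega) s1 (hs.frame hd hD hf)
    have hv1 : s2.reg d = e.eval s := (hf'.reg d (by omega)).trans hv
    have := eval_le hB e he.1
    have := eval_le hB f he.2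
    refine ⟨_, (r1.seq (r2.seq (Run.sub _ _ _ _))).mono ?_, ?_,
      (hf.trans (hf'.mono (by omega))).setReg le_rfl⟩
    · simp only [time]; omega
    · simp [eval, hv1, hv']
  | mul e f ihe ihf =>
    obtain ⟨s1, r1, hv, hf⟩ := ihe he.1 d hd s' hs
    obtain ⟨s2, r2, hv', hf'⟩ := ihf he.2 (d + 1) (by omega) s1 (hs.frame hd hD hf)
    have hv1 : s2.reg d = e.eval s := (hf'.reg d (by omega)).trans hv
    obtain ⟨s3, r3, hv3, hf3⟩ := run_mulProg d s2
    refine ⟨s3, (r1.seq (r2.seq r3)).mono ?_, by simp [eval, hv3, hv1, hv'],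
      (hf.trans (hf'.mono (by omega))).trans hf3⟩
    have := mulTime_mono (eval_le hB e he.1) (eval_le hB f he.2)
    rw [hv1, hv']
    simp only [time]; omega
  | div e f ihe ihf =>
    obtain ⟨s1, r1, hv, hf⟩ := ihe he.1 d hd s' hs
    obtain ⟨s2, r2, hv', hf'⟩ := ihf he.2 (d + 1) (by omega) s1 (hs.frame hd hD hf)
    have hv1 : s2.reg d = e.eval s := (hf'.reg d (by omega)).trans hv
    obtain ⟨s3, r3, hv3, hf3⟩ := run_divProg d s2
    refine ⟨s3, (r1.seq (r2.seq r3)).mono ?_, by simp [eval, hv3, hv1, hv'],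
      (hf.trans (hf'.mono (by omega))).trans hf3⟩
    have := divTime_mono (eval_le hB e he.1) (eval_le hB f he.2)
    rw [hv1, hv']
    simp only [time]; omega
  | ite c e f ihc ihe ihf =>
    obtain ⟨s1, r1, hv, hf⟩ := ihc he.1 d hd s' hs
    have hb := eval_le hB c he.1
    by_cases h0 : c.eval s = 0
    · obtain ⟨s2, r2, hv', hf'⟩ := ihf he.2.2 d hd s1 (hs.frame hd hD hf)
      refine ⟨s2, (r1.seq (Run.cond_false (hv.trans h0) r2)).mono ?_, by simp [eval, h0, hv'],
        hf.trans hf'⟩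
      simp only [time]; omega
    · obtain ⟨s2, r2, hv', hf'⟩ := ihe he.2.1 d hd s1 (hs.frame hd hD hf)
      refine ⟨s2, (r1.seq (Run.cond_true (by rwa [hv]) r2)).mono ?_, by simp [eval, h0, hv'],
        hf.trans hf'⟩
      simp only [time]; omega
  | tbl l e ih =>
    obtain ⟨s1, r1, hv, hf⟩ := ih he d hd s' hs
    obtain ⟨s2, r2, hv', hf'⟩ := run_tblProg d l s1
    refine ⟨s2, (r1.seq r2).mono ?_, by simp only [eval, hv', hv], hf.trans hf'⟩
    rw [hv]
    have : tblTime l (e.eval s) ≤ tblTime l (e.bound B) := by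
      have := eval_le hB e he
      unfold tblTime; gcongr
    simp only [time]; omega

/-- `1` if `e < f` and `0` otherwise. -/
def lt (e f : Expr) : Expr := ite (sub f e) (const 1) (const 0)

/-- `1` if `e = f` and `0` otherwise. -/
def eq (e f : Expr) : Expr := ite (add (sub e f) (sub f e)) (const 0) (const 1)

/-- The remainder of `e` modulo `f`. -/
def mod (e f : Expr) : Expr := sub e (mul f (div e f))

@[simp] theorem eval_lt (s : State) (e f : Expr) :
    (lt e f).eval s = if e.eval s < f.eval s then 1 else 0 := by
  by_cases h : e.eval s < f.eval s
  · rw [if_pos h]; exact if_pos (Nat.sub_ne_zero_of_lt h)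
  · rw [if_neg h]; exact if_neg (not_not_intro (Nat.sub_eq_zero_of_le (not_lt.mp h)))

@[simp] theorem eval_eq (s : State) (e f : Expr) :
    (eq e f).eval s = if e.eval s = f.eval s then 1 else 0 := by
  by_cases h : e.eval s = f.eval s
  · have h' : e.eval s - f.eval s + (f.eval s - e.eval s) = 0 := by omega
    rw [if_pos h]; exact if_neg (not_not_intro h')
  · have h' : e.eval s - f.eval s + (f.eval s - e.eval s) ≠ 0 := by omega
    rw [if_neg h]; exact if_pos h'

@[simp] theorem eval_mod (s : State) (e f : Expr) : (mod e f).eval s = e.eval s % f.eval s := by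
  simp only [mod, eval]; rw [Nat.mod_eq_sub]

end Expr

/-- Statements: assignments, writing to arrays, and loops with a predetermined number of rounds. -/
inductive Stmt where
  /-- `R i := e` -/
  | assign (i : ℕ) (e : Expr)
  /-- `A a [e] := f` -/
  | store (a : ℕ) (e f : Expr)
  | seq (p q : Stmt)
  /-- repeat `p` as often as the value of `e` says -/
  | rep (e : Expr) (p : Stmt)

namespace Stmt

/-- The configuration after the execution of a statement. -/
def eval : Stmt → State → State
  | assign i e, s => s.setReg i (e.eval s)
  | store a e f, s => s.setArr a (e.eval s) (f.eval s)
  | seq p q, s => q.eval (p.eval s)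
  | rep e p, s => p.eval^[e.eval s] s

/-- All registers in the statement are below `D`. -/
def VarsBelow (D : ℕ) : Stmt → Prop
  | assign i e => i < D ∧ e.VarsBelow D
  | store _ e f => e.VarsBelow D ∧ f.VarsBelow D
  | seq p q => p.VarsBelow D ∧ q.VarsBelow D
  | rep e p => e.VarsBelow D ∧ p.VarsBelow D

/-- Whenever the statement, started in `s`, evaluates an expression, all numbers in the memory are
at most `B`. -/
def Within (D B : ℕ) : Stmt → State → Prop
  | assign _ _, s => s.BddBy D B
  | store _ _ _, s => s.BddBy D B
  | seq p q, s => p.Within D B s ∧ q.Within D B (p.eval s)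
  | rep e p, s => s.BddBy D B ∧ ∀ k < e.eval s, p.Within D B (p.eval^[k] s)

/-- A bound for the running time if all numbers in the memory are at most `B`. -/
def time (B : ℕ) : Stmt → ℕ
  | assign _ e => e.time B + (1 + (1 + e.bound B))
  | store _ e f => e.time B + (f.time B + (1 + e.bound B + f.bound B))
  | seq p q => p.time B + q.time B
  | rep e p => e.time B + (e.bound B * (p.time B + 5 + 2 * e.bound B) + 1)

/-- The machine program for a statement; the registers from `d` on serve as scratch space. -/
def compile (N : ℕ) : Stmt → ℕ → Prog
  | assign i e, d => .seq (e.compile N d) (.seq (.const (d + 1) 0) (.add (ren N i) d (d + 1)))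
  | store a e f, d =>
    .seq (e.compile N d) (.seq (f.compile N (d + 1)) (.store (ren N a) d (d + 1)))
  | seq p q, d => .seq (p.compile N d) (q.compile N d)
  | rep e p, d => .seq (e.compile N d) (.loop d
      (.seq (p.compile N (d + 1)) (.seq (.const (d + 1) 1) (.sub d d (d + 1)))))

/-- The compiler is correct. -/
theorem run_compile {N D B : ℕ} (hD : 0 < D) (p : Stmt) (hp : p.VarsBelow D) (d : ℕ)
    (hd : N + D ≤ d) (s s' : State) (hB : p.Within D B s) (hs : Sim N D s s') :
    ∃ s'', Run (p.compile N d) s' (p.time B) s'' ∧ Sim N D (p.eval s) s'' ∧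
      ∀ i, N + D ≤ i → i < d → s''.reg i = s'.reg i := by
  induction p generalizing d s s' with
  | assign i e =>
    obtain ⟨s1, r1, hv, hf⟩ := e.run_compile hD hB hp.2 d hd s' hs
    have hb := e.eval_le hB hp.2
    refine ⟨_, (r1.seq ((Run.const _ _ _).seq (Run.add _ _ _ _))).mono ?_, ⟨?_, ?_, ?_, ?_⟩, ?_⟩
    · simp [time, hv]; omega
    · intro j hj
      have hlt := (ren_lt (N := N) hj).trans_le hd
      have hs1 := hs.frame hd hD hf
      by_cases hji : j = i
      · subst hji; simp [eval, hv]
      · simp [eval, hji, (ren_injective N).eq_iff, (show ren N j ≠ d + 1 by omega), hs1.reg j hj]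
    · intro a
      simp [eval, hf.arr, hs.arr]
    · intro j hj hj'
      have hs1 := hs.frame hd hD hf
      simp [ren_ne hj hj', (show j ≠ d + 1 by omega), hs1.reg_zero j hj hj']
    · intro a ha ha'
      simp [hf.arr, hs.arr_zero a ha ha']
    · intro j hj hj'
      have hlt := ren_lt (N := N) hp.1
      simp [(show j ≠ ren N i by omega), (show j ≠ d + 1 by omega), hf.reg j hj']
  | store a e f =>
    obtain ⟨s1, r1, hv, hf⟩ := e.run_compile hD hB hp.1 d hd s' hs
    obtain ⟨s2, r2, hv', hf'⟩ := f.run_compile hD hB hp.2 (d + 1) (by omega) s1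
      (hs.frame hd hD hf)
    have hv1 : s2.reg d = e.eval s := (hf'.reg d (by omega)).trans hv
    have hs2 := hs.frame hd hD (hf.trans (hf'.mono (by omega)))
    have := e.eval_le hB hp.1
    have := f.eval_le hB hp.2
    refine ⟨_, (r1.seq (r2.seq (Run.store _ _ _ _))).mono ?_, ⟨?_, ?_, ?_, ?_⟩, ?_⟩
    · simp only [time]; omega
    · intro j hj
      simp [eval, hs2.reg j hj]
    · intro b
      ext j
      simp only [eval, State.arr_setArr, (ren_injective N).eq_iff, hs2.arr, hv1, hv']
    · intro j hj hj'
      simp [hs2.reg_zero j hj hj']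
    · intro b hb hb'
      ext j
      simp [State.arr_setArr, ren_ne hb hb', hs2.arr_zero b hb hb']
    · intro j hj hj'
      rw [State.reg_setArr, hf'.reg j (by omega), hf.reg j hj']
  | seq p q ihp ihq =>
    obtain ⟨s1, r1, hs1, hf1⟩ := ihp hp.1 d hd s s' hB.1 hs
    obtain ⟨s2, r2, hs2, hf2⟩ := ihq hp.2 d hd _ s1 hB.2 hs1
    exact ⟨s2, r1.seq r2, hs2, fun i hi hi' => (hf2 i hi hi').trans (hf1 i hi hi')⟩
  | rep e p ih =>
    obtain ⟨s1, r1, hv, hf⟩ := e.run_compile hD hB.1 hp.1 d hd s' hs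
    have hb := e.eval_le hB.1 hp.1
    have hs1 := hs.frame hd hD hf
    -- register `d` counts the remaining rounds
    have key : ∀ (n : ℕ) (u u' : State), n ≤ e.bound B → u'.reg d = n → Sim N D u u' →
        (∀ k < n, p.Within D B (p.eval^[k] u)) →
        ∃ u'', Run (.loop d (.seq (p.compile N (d + 1)) (.seq (.const (d + 1) 1)
            (.sub d d (d + 1))))) u' (n * (p.time B + 5 + 2 * e.bound B) + 1) u'' ∧
          Sim N D (p.eval^[n] u) u'' ∧ ∀ i, N + D ≤ i → i < d → u''.reg i = u'.reg i := by
      intro n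
      induction n with
      | zero =>
        intro u u' _ h0 hu _
        exact ⟨u', (Run.loop_false h0).mono (by omega), hu, fun _ _ _ => rfl⟩
      | succ n ihn =>
        intro u u' hn h0 hu hW
        obtain ⟨u1, q1, hu1, hf1⟩ := ih hp.2 (d + 1) (by omega) u u' (hW 0 (by omega)) hu
        have q2 := Run.const u1 (d + 1) 1
        have q3 := Run.sub (u1.setReg (d + 1) 1) d d (d + 1)
        have hd1 : u1.reg d = n + 1 := (hf1 d hd (by omega)).trans h0
        set u3 := (u1.setReg (d + 1) 1).setReg d
          ((u1.setReg (d + 1) 1).reg d - (u1.setReg (d + 1) 1).reg (d + 1)) with hu3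
        have hfr : Frame d u1 u3 := ((Frame.refl _ _).setReg (by omega)).setReg (by omega)
        obtain ⟨u4, q4, hu4, hf4⟩ := ihn (p.eval u) u3 (by omega) (by simp [u3, hd1])
          (hu1.frame hd hD hfr) (fun k hk => hW (k + 1) (by omega))
        refine ⟨u4, (Run.loop_true (by omega) (q1.seq (q2.seq q3)) q4).mono ?_, hu4, ?_⟩
        · simp only [State.reg_setReg, if_true, hd1, h0, if_neg (show d ≠ d + 1 by omega), add_mul]
          omega
        · intro i hi hi'
          rw [hf4 i hi hi', hfr.reg i hi', hf1 i hi (by omega)]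
    obtain ⟨s2, r2, hs2, hf2⟩ := key _ s s1 hb hv hs1 hB.2
    refine ⟨s2, (r1.seq r2).mono ?_, hs2, fun i hi hi' => (hf2 i hi hi').trans (hf.reg i hi')⟩
    simp only [time]
    gcongr

/-- Fill the first `len` cells of array `a` with the values that `F` takes while register `i` runs
over `0, 1, …`. -/
def fill (a i : ℕ) (len F : Expr) : Stmt :=
  .seq (.assign i (.const 0))
    (.rep len (.seq (.store a (.var i) F) (.assign i (.add (.var i) (.const 1)))))

end Stmt

/-- `s` with the first `k` cells of array `a` replaced by the values of `f`, and with `R i = k`. -/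
def State.fill (s : State) (a i : ℕ) (f : ℕ → ℕ) (k : ℕ) : State where
  reg := Function.update s.reg i k
  arr := Function.update s.arr a fun j => if j < k then f j else s.arr a j

theorem State.BddBy.fill {D B a i k : ℕ} {s : State} {f : ℕ → ℕ} (hs : s.BddBy D B) (hk : k ≤ B)
    (hf : ∀ j < k, f j ≤ B) : (s.fill a i f k).BddBy D B where
  reg j hj := by
    simp only [State.fill, Function.update_apply]
    split_ifs
    · exact hk
    · exact hs.reg j hj
  arr b j := by
    simp only [State.fill, Function.update_apply]
    split_ifs with h1
    · beta_reduce
      split_ifs with h2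
      · exact hf j h2
      · exact hs.arr a j
    · exact hs.arr b j

/-- Correctness of `Stmt.fill`.  The expression `F` may read the part of the array that is already
filled. -/
theorem Stmt.fill_spec {D B a i ℓ : ℕ} {len F : Expr} {s : State} (f : ℕ → ℕ) (hs : s.BddBy D B)
    (hlen : len.eval (s.setReg i 0) = ℓ) (hℓ : ℓ ≤ B)
    (hF : ∀ k < ℓ, F.eval (s.fill a i f k) = f k) (hf : ∀ k < ℓ, f k ≤ B) :
    (Stmt.fill a i len F).Within D B s ∧ (Stmt.fill a i len F).eval s = s.fill a i f ℓ := by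
  have h0 : s.setReg i 0 = s.fill a i f 0 := by
    simp [State.setReg, State.fill]
  have hstore : ∀ k < ℓ, (Stmt.store a (.var i) F).eval (s.fill a i f k) =
      { s.fill a i f k with arr := (s.fill a i f (k + 1)).arr } := by
    intro k hk
    simp only [Stmt.eval, hF k hk, Expr.eval]
    ext b j
    · simp
    · simp only [State.arr_setArr]
      simp only [State.fill, Function.update_self, Function.update_apply]
      by_cases hb : b = a
      · subst hb
        simp only [if_true, true_and]
        by_cases hj : j = k
        · simp [hj]
        · simp only [hj, if_false]
          by_cases hj' : j < k
          · rw [if_pos hj', if_pos (by omega)]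
          · rw [if_neg hj', if_neg (by omega)]
      · simp [hb]
  have hstep : ∀ k < ℓ, (Stmt.seq (.store a (.var i) F)
      (.assign i (.add (.var i) (.const 1)))).eval (s.fill a i f k) = s.fill a i f (k + 1) := by
    intro k hk
    rw [Stmt.eval, hstore k hk]
    simp [Stmt.eval, Expr.eval, State.setReg, State.fill]
  have hiter : ∀ k ≤ ℓ, (Stmt.seq (.store a (.var i) F)
      (.assign i (.add (.var i) (.const 1)))).eval^[k] (s.fill a i f 0) = s.fill a i f k := by
    intro k
    induction k with
    | zero => intro _; rfl
    | succ k ih =>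
      intro hk
      rw [Function.iterate_succ_apply', ih (by omega), hstep k (by omega)]
  have hbd : ∀ k ≤ ℓ, (s.fill a i f k).BddBy D B := fun k hk =>
    hs.fill (by omega) fun j hj => hf j (by omega)
  have hfirst : (Stmt.assign i (.const 0)).eval s = s.fill a i f 0 := by
    rw [← h0]; rfl
  refine ⟨⟨hs, ?_, fun k hk => ?_⟩, ?_⟩
  · rw [hfirst]; exact hbd 0 (by omega)
  · rw [hfirst] at hk ⊢
    rw [← h0, hlen] at hk
    rw [hiter k hk.le]
    refine ⟨hbd k hk.le, ?_⟩
    rw [hstore k hk]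
    exact ⟨(hbd k hk.le).reg, (hbd (k + 1) hk).arr⟩
  · rw [Stmt.fill, Stmt.eval, hfirst, Stmt.eval, ← h0, hlen, h0, hiter ℓ le_rfl]

/-! ### Polynomial bounds -/

/-- `f` is bounded by a polynomial. -/
def PolyBdd (f : ℕ → ℕ) : Prop := ∃ d, ∀ n, f n ≤ (n + 2) ^ d

namespace PolyBdd

theorem const (c : ℕ) : PolyBdd fun _ => c :=
  ⟨c, fun n => c.lt_two_pow_self.le.trans (Nat.pow_le_pow_left (by omega) c)⟩

theorem id : PolyBdd fun n => n := ⟨1, fun n => by simp⟩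

theorem mono {f g : ℕ → ℕ} (hg : PolyBdd g) (h : ∀ n, f n ≤ g n) : PolyBdd f :=
  let ⟨d, hd⟩ := hg
  ⟨d, fun n => (h n).trans (hd n)⟩

theorem add {f g : ℕ → ℕ} (hf : PolyBdd f) (hg : PolyBdd g) : PolyBdd fun n => f n + g n := by
  obtain ⟨d, hd⟩ := hf
  obtain ⟨e, he⟩ := hg
  refine ⟨d + e + 1, fun n => ?_⟩
  have h1 : (n + 2) ^ d ≤ (n + 2) ^ (d + e) := Nat.pow_le_pow_right (by omega) (by omega)
  have h2 : (n + 2) ^ e ≤ (n + 2) ^ (d + e) := Nat.pow_le_pow_right (by omega) (by omega)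
  have h3 : (n + 2) ^ (d + e) * 2 ≤ (n + 2) ^ (d + e) * (n + 2) :=
    Nat.mul_le_mul_left _ (by omega)
  have := hd n
  have := he n
  rw [pow_succ]
  beta_reduce
  omega

theorem mul {f g : ℕ → ℕ} (hf : PolyBdd f) (hg : PolyBdd g) : PolyBdd fun n => f n * g n := by
  obtain ⟨d, hd⟩ := hf
  obtain ⟨e, he⟩ := hg
  exact ⟨d + e, fun n => by rw [pow_add]; exact Nat.mul_le_mul (hd n) (he n)⟩

theorem pow {f : ℕ → ℕ} (hf : PolyBdd f) (e : ℕ) : PolyBdd fun n => f n ^ e := by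
  obtain ⟨d, hd⟩ := hf
  exact ⟨d * e, fun n => by rw [pow_mul]; exact Nat.pow_le_pow_left (hd n) e⟩

end PolyBdd

theorem Expr.polyBdd_bound (e : Expr) : PolyBdd fun B => e.bound B := by
  induction e with
  | const c => exact .const c
  | var i => exact .id
  | arr a e _ => exact .id
  | add e f ihe ihf => exact ihe.add ihf
  | sub e f ihe _ => exact ihe
  | mul e f ihe ihf => exact ihe.mul ihf
  | div e f ihe _ => exact ihe
  | ite c e f _ ihe ihf => exact ihe.add ihf
  | tbl l e _ => exact .const _

theorem PolyBdd.mulTime {f g : ℕ → ℕ} (hf : PolyBdd f) (hg : PolyBdd g) :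
    PolyBdd fun n => mulTime (f n) (g n) :=
  ((hg.mul ((((const 10).add ((const 2).mul hg)).add (hf.mul hg)).add hf)).add (hf.mul hg)).add
    (const 10)

theorem PolyBdd.divTime {f g : ℕ → ℕ} (hf : PolyBdd f) (hg : PolyBdd g) :
    PolyBdd fun n => divTime (f n) (g n) :=
  ((((hf.add (const 1)).mul (((const 20).add ((const 10).mul hf)).add ((const 10).mul hg))).add
    (const 20)).add ((const 10).mul hf)).add ((const 10).mul hg)

theorem PolyBdd.tblTime {f : ℕ → ℕ} (hf : PolyBdd f) (l : List ℕ) :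
    PolyBdd fun n => tblTime l (f n) :=
  (((const _).mul ((const 6).add ((const 2).mul hf))).add (const _)).add (const 2)

theorem Expr.polyBdd_time (e : Expr) : PolyBdd fun B => e.time B := by
  induction e with
  | const c => exact .const _
  | var i => exact (PolyBdd.const 2).add .id
  | arr a e ih => exact ih.add (((PolyBdd.const 1).add e.polyBdd_bound).add .id)
  | add e f ihe ihf | sub e f ihe ihf =>
    exact ihe.add (ihf.add (((PolyBdd.const 1).add e.polyBdd_bound).add f.polyBdd_bound))
  | mul e f ihe ihf => exact ihe.add (ihf.add (e.polyBdd_bound.mulTime f.polyBdd_bound))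
  | div e f ihe ihf => exact ihe.add (ihf.add (e.polyBdd_bound.divTime f.polyBdd_bound))
  | ite c e f ihc ihe ihf =>
    exact ihc.add (((PolyBdd.const 1).add c.polyBdd_bound).add (ihe.add ihf))
  | tbl l e ih => exact ih.add (e.polyBdd_bound.tblTime l)

theorem Stmt.polyBdd_time (p : Stmt) : PolyBdd fun B => p.time B := by
  induction p with
  | assign i e => exact e.polyBdd_time.add ((PolyBdd.const 1).add ((PolyBdd.const 1).add
      e.polyBdd_bound))
  | store a e f => exact e.polyBdd_time.add (f.polyBdd_time.add
      (((PolyBdd.const 1).add e.polyBdd_bound).add f.polyBdd_bound))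
  | seq p q ihp ihq => exact ihp.add ihq
  | rep e p ih => exact e.polyBdd_time.add ((e.polyBdd_bound.mul
      ((ih.add (PolyBdd.const 5)).add ((PolyBdd.const 2).mul e.polyBdd_bound))).add
      (PolyBdd.const 1))

/-! ### Running a program on the output of another one -/

/-- The numbers of all registers and arrays that the program names are at most `N`. -/
def Prog.NamesLE (N : ℕ) : Prog → Prop
  | .const i _ => i ≤ N
  | .add i j k => i ≤ N ∧ j ≤ N ∧ k ≤ N
  | .sub i j k => i ≤ N ∧ j ≤ N ∧ k ≤ N
  | .load i a j => i ≤ N ∧ a ≤ N ∧ j ≤ N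
  | .store a i j => a ≤ N ∧ i ≤ N ∧ j ≤ N
  | .seq p q => p.NamesLE N ∧ q.NamesLE N
  | .cond i p q => i ≤ N ∧ p.NamesLE N ∧ q.NamesLE N
  | .loop i p => i ≤ N ∧ p.NamesLE N

theorem Prog.NamesLE.mono {N N' : ℕ} (h : N ≤ N') {p : Prog} (hp : p.NamesLE N) :
    p.NamesLE N' := by
  induction p <;> simp only [NamesLE] at * <;> grind

theorem Prog.exists_namesLE (p : Prog) : ∃ N, p.NamesLE N := by
  induction p with
  | const i c => exact ⟨i, le_rfl⟩
  | add i j k | sub i j k | load i j k | store i j k =>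
    exact ⟨i + j + k, by simp only [NamesLE]; omega⟩
  | seq p q ihp ihq =>
    obtain ⟨M, hM⟩ := ihp
    obtain ⟨N, hN⟩ := ihq
    exact ⟨M + N, hM.mono (by omega), hN.mono (by omega)⟩
  | cond i p q ihp ihq =>
    obtain ⟨M, hM⟩ := ihp
    obtain ⟨N, hN⟩ := ihq
    exact ⟨i + M + N, by omega, hM.mono (by omega), hN.mono (by omega)⟩
  | loop i p ih =>
    obtain ⟨M, hM⟩ := ih
    exact ⟨i + M, by omega, hM.mono (by omega)⟩

/-- The configurations agree on the registers and arrays `0, …, N`. -/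
structure AgreeLE (N : ℕ) (s s' : State) : Prop where
  reg : ∀ i ≤ N, s'.reg i = s.reg i
  arr : ∀ a ≤ N, s'.arr a = s.arr a

theorem AgreeLE.setReg {N : ℕ} {s s' : State} (h : AgreeLE N s s') (i v : ℕ) :
    AgreeLE N (s.setReg i v) (s'.setReg i v) where
  reg j hj := by simp [h.reg j hj]
  arr a ha := h.arr a ha

theorem AgreeLE.setArr {N : ℕ} {s s' : State} (h : AgreeLE N s s') (a i v : ℕ) :
    AgreeLE N (s.setArr a i v) (s'.setArr a i v) where
  reg j hj := h.reg j hj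
  arr b hb := by ext j; simp [State.arr_setArr, h.arr b hb]

/-- A program does not depend on registers and arrays that it does not name. -/
theorem Exec.of_agreeLE {N : ℕ} {p : Prog} {s s₁ s' : State} {t : ℕ} (h : Exec p s t s₁)
    (hp : p.NamesLE N) (hs : AgreeLE N s s') : ∃ s₁', Exec p s' t s₁' ∧ AgreeLE N s₁ s₁' := by
  induction h generalizing s' with
  | const s i c => exact ⟨_, .const s' i c, hs.setReg _ _⟩
  | add s i j k =>
    rw [← hs.reg j hp.2.1, ← hs.reg k hp.2.2]
    exact ⟨_, .add s' i j k, hs.setReg _ _⟩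
  | sub s i j k =>
    rw [← hs.reg j hp.2.1, ← hs.reg k hp.2.2]
    exact ⟨_, .sub s' i j k, hs.setReg _ _⟩
  | load s i a j =>
    rw [← hs.reg j hp.2.2, ← hs.arr a hp.2.1]
    exact ⟨_, .load s' i a j, hs.setReg _ _⟩
  | store s a i j =>
    rw [← hs.reg i hp.2.1, ← hs.reg j hp.2.2]
    exact ⟨_, .store s' a i j, hs.setArr _ _ _⟩
  | seq _ _ ih ih' =>
    obtain ⟨s₁, h₁, hs₁⟩ := ih hp.1 hs
    obtain ⟨s₂, h₂, hs₂⟩ := ih' hp.2 hs₁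
    exact ⟨s₂, .seq h₁ h₂, hs₂⟩
  | cond_true h _ ih =>
    obtain ⟨s₁, h₁, hs₁⟩ := ih hp.2.1 hs
    rw [← hs.reg _ hp.1] at h ⊢
    exact ⟨s₁, .cond_true h h₁, hs₁⟩
  | cond_false h _ ih =>
    obtain ⟨s₁, h₁, hs₁⟩ := ih hp.2.2 hs
    rw [← hs.reg _ hp.1] at h
    exact ⟨s₁, .cond_false h h₁, hs₁⟩
  | loop_true h _ _ ih ih' =>
    obtain ⟨s₁, h₁, hs₁⟩ := ih hp.2 hs
    obtain ⟨s₂, h₂, hs₂⟩ := ih' hp hs₁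
    rw [← hs.reg _ hp.1] at h ⊢
    exact ⟨s₂, .loop_true h h₁ h₂, hs₂⟩
  | loop_false h =>
    rw [← hs.reg _ hp.1] at h
    exact ⟨s', .loop_false h, hs⟩

/-- A statement that turns the input word `w` into the input word `w'` can be put in front of a
program. -/
theorem exists_exec_comp {N D B t : ℕ} (hD : 0 < D) {p : Stmt} (hp : p.VarsBelow D) {q : Prog}
    (hq : q.NamesLE N) {w w' : List ℕ} {s' : State} (hB : p.Within D B (initial w))
    (hreg : (p.eval (initial w)).reg 0 = w'.length)
    (harr : (p.eval (initial w)).arr 0 = fun i => w'.getD i 0) (h : Exec q (initial w') t s') :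
    ∃ t' s'', Exec (.seq (p.compile N (N + D)) q) (initial w) t' s'' ∧ t' ≤ p.time B + t ∧
      s''.reg 0 = s'.reg 0 := by
  have hs : Sim N D (initial w) (initial w) := by
    refine ⟨fun i _ => ?_, fun a => ?_, fun i hi _ => ?_, fun a ha _ => ?_⟩
    · by_cases hi : i = 0
      · simp [hi, ren]
      · simp [initial, ren, hi]
    · by_cases ha : a = 0
      · simp [ha, ren]
      · simp [initial, ren, ha]
    · simp [initial, show i ≠ 0 by omega]
    · simp [initial, show a ≠ 0 by omega]
  obtain ⟨s₁, ⟨t₁, ht₁, r₁⟩, hs₁, -⟩ := p.run_compile hD hp (N + D) le_rfl _ _ hB hs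
  have hag : AgreeLE N (initial w') s₁ := by
    refine ⟨fun i hi => ?_, fun a ha => ?_⟩
    · rcases Nat.eq_zero_or_pos i with rfl | h0
      · rw [← ren_zero N, hs₁.reg 0 hD, hreg]; rfl
      · rw [hs₁.reg_zero i h0 hi]; simp [initial, h0.ne']
    · rcases Nat.eq_zero_or_pos a with rfl | h0
      · rw [← ren_zero N, hs₁.arr 0, harr]; simp [initial, ren]
      · rw [hs₁.arr_zero a h0 ha]; simp [initial, h0.ne']
  obtain ⟨s₂, r₂, hs₂⟩ := h.of_agreeLE hq hag
  exact ⟨_, s₂, .seq r₁ r₂, by omega, hs₂.reg 0 (Nat.zero_le _)⟩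

end RAM

/-! ### Encoding assignments of blocks of variables by sets of equal size -/

/-- An injective encoding of the numbers `τ < 2 ^ g`, which stand for the assignments of `g`
variables (bit `r` is the value of variable `r`), by `h`-subsets of a set with `2 * h` elements.
As the sets have equal size, none of them contains another one. -/
structure BalancedCode (g h : ℕ) where
  mem : ℕ → ℕ → Bool
  card : ∀ τ < 2 ^ g, (Finset.univ.filter fun x : Fin (2 * h) => mem τ x = true).card = h
  inj : ∀ τ < 2 ^ g, ∀ τ' < 2 ^ g, (∀ x < 2 * h, mem τ x = true → mem τ' x = true) → τ = τ'

theorem BalancedCode.exists_of_le {g h : ℕ} (hgh : 2 ^ g ≤ h.centralBinom) :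
    Nonempty (BalancedCode g h) := by
  classical
  obtain ⟨f⟩ : Nonempty (Fin (2 ^ g) ↪
      (Finset.powersetCard h (Finset.univ : Finset (Fin (2 * h))))) :=
    Function.Embedding.nonempty_of_card_le (by simpa [Nat.centralBinom] using hgh)
  have hcard : ∀ τ, (f τ : Finset (Fin (2 * h))).card = h := fun τ =>
    (Finset.mem_powersetCard.mp (f τ).2).2
  let mem : ℕ → ℕ → Bool := fun τ x =>
    decide (∃ (hτ : τ < 2 ^ g) (hx : x < 2 * h), (⟨x, hx⟩ : Fin (2 * h)) ∈ (f ⟨τ, hτ⟩).1)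
  have hmem : ∀ τ (hτ : τ < 2 ^ g) (x : Fin (2 * h)), mem τ x = true ↔ x ∈ (f ⟨τ, hτ⟩).1 := by
    intro τ hτ x
    simp [mem, hτ]
  refine ⟨⟨mem, fun τ hτ => ?_, fun τ hτ τ' hτ' hsub => ?_⟩⟩
  · refine (congrArg Finset.card ?_).trans (hcard ⟨τ, hτ⟩)
    ext x
    simp [hmem τ hτ]
  · have hsub' : (f ⟨τ, hτ⟩).1 ⊆ (f ⟨τ', hτ'⟩).1 := fun x hx =>
      (hmem τ' hτ' x).mp (hsub x x.2 ((hmem τ hτ x).mpr hx))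
    have := Finset.eq_of_subset_of_card_le hsub' (by rw [hcard, hcard])
    simpa using f.injective (Subtype.ext this)

/-! ### The gadgets of a formula -/

namespace CNFFormula

variable {g h : ℕ}

/-- The number of blocks of `g` consecutive variables; the last one may be incomplete or empty. -/
def blocks (g : ℕ) (φ : CNFFormula) : ℕ := φ.n / g + 1

/-- The slot `(j, τ)` of the gadget of a clause says that literal `j` of the clause is true under
the assignment `τ` of its block, and requires the deletion of the code set of `τ` in that block.
If there is no literal `j` or `τ` makes it false, then all vertices would have to be deleted.
The slot `(j, τ)` of the gadget of a block says that the block has the assignment `τ`. -/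
def Requires (code : BalancedCode g h) (q : ℕ) (φ : CNFFormula) :
    Fin φ.clauses.length ⊕ Fin (φ.blocks g) → Fin (q + 1) × Fin (2 ^ g) →
      Fin (φ.blocks g) × Fin (2 * h) → Prop
  | .inl c, (j, τ), (b, x) => ∀ l ∈ (φ.clauses.get c)[(j : ℕ)]?,
      (τ : ℕ).testBit (l.1 % g) = l.2 → (b : ℕ) = l.1 / g ∧ code.mem τ x = true
  | .inr b', (_, τ), (b, x) => b = b' ∧ code.mem τ x = true

theorem card_eq_sum_block {n k : ℕ} (Y : Finset (Fin n × Fin k)) :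
    Y.card = ∑ b, (Finset.univ.filter fun x => (b, x) ∈ Y).card := by
  rw [Finset.card_eq_sum_card_fiberwise (f := Prod.fst) (t := Finset.univ) (by simp [Set.MapsTo])]
  refine Finset.sum_congr rfl fun b _ => ?_
  refine Finset.card_nbij' (fun p => p.2) (fun x => (b, x)) ?_ ?_ ?_ ?_
  · rintro ⟨b', x⟩ hx
    simp at hx
    simp [← hx.2, hx.1]
  · intro x hx
    simpa using hx
  · rintro ⟨b', x⟩ hx
    simp at hx
    simp [hx.2]
  · intro x _
    rfl

/-- A formula is satisfiable if and only if some set with `h` vertices for each block meets the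
requirement of a slot of every gadget.  The gadgets of the blocks force such a set to be a union of
code sets, one in each block. -/
theorem satisfiable_iff_exists_cover (code : BalancedCode g h) (hg : 0 < g) (hh : 0 < h) {q : ℕ}
    (φ : CNFFormula) (hq : ∀ c ∈ φ.clauses, c.length ≤ q) :
    φ.Satisfiable ↔ ∃ Y : Finset (Fin (φ.blocks g) × Fin (2 * h)), Y.card ≤ φ.blocks g * h ∧
      ∀ c, ∃ w, ∀ x, φ.Requires code q c w x → x ∈ Y := by
  have hdiv : ∀ i : Fin φ.n, (i : ℕ) / g < φ.blocks g := fun i =>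
    Nat.lt_succ_of_le (Nat.div_le_div_right i.2.le)
  constructor
  · rintro ⟨a, ha⟩
    have hτ : ∀ b, ∃ τ < 2 ^ g, ∀ i : Fin φ.n, (i : ℕ) / g = b → τ.testBit (i % g) = a i := by
      intro b
      refine ⟨Nat.ofBits fun r : Fin g =>
        if hr : g * b + r < φ.n then a ⟨g * b + r, hr⟩ else false, Nat.ofBits_lt_two_pow _, ?_⟩
      rintro i rfl
      rw [Nat.testBit_ofBits_lt _ _ (Nat.mod_lt _ hg)]
      simp [Nat.div_add_mod]
    choose τ hτ hτa using hτ
    refine ⟨Finset.univ.filter fun p => code.mem (τ p.1) p.2 = true, ?_, ?_⟩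
    · rw [card_eq_sum_block, Finset.sum_congr rfl (g := fun _ => h) fun b _ => ?_]
      · simp
      · simpa using code.card _ (hτ b)
    · rintro (c | b)
      · obtain ⟨l, hl, hal⟩ := ha _ (List.get_mem φ.clauses c)
        obtain ⟨j, hj, hjl⟩ := List.mem_iff_getElem.mp hl
        have hjq : j < q + 1 := by
          have := hq _ (List.get_mem φ.clauses c)
          omega
        refine ⟨(⟨j, hjq⟩, ⟨τ (l.1 / g), hτ _⟩), ?_⟩
        rintro ⟨b, x⟩ hx
        have := hx l ((List.getElem?_eq_getElem hj).trans (congrArg some hjl)) (by simp [hτa _ l.1 rfl, hal])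
        simp [this.1, this.2]
      · refine ⟨(0, ⟨τ b, hτ _⟩), ?_⟩
        rintro ⟨b', x⟩ ⟨rfl, hx⟩
        simpa using hx
  · rintro ⟨Y, hY, hcov⟩
    have hblock : ∀ b : Fin (φ.blocks g), ∃ τ < 2 ^ g,
        ∀ x : Fin (2 * h), code.mem τ x = true → (b, x) ∈ Y := by
      intro b
      obtain ⟨⟨j, τ⟩, hw⟩ := hcov (.inr b)
      exact ⟨τ, τ.2, fun x hx => hw (b, x) ⟨rfl, hx⟩⟩
    choose τ hτ hτY using hblock
    have hsub : ∀ b, (Finset.univ.filter fun x : Fin (2 * h) => code.mem (τ b) x = true) ⊆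
        Finset.univ.filter fun x => (b, x) ∈ Y := fun b x hx => by
      simpa using hτY b x (by simpa using hx)
    have hle : ∀ b ∈ Finset.univ, h ≤ (Finset.univ.filter fun x => (b, x) ∈ Y).card :=
      fun b _ => (code.card _ (hτ b)).symm.le.trans (Finset.card_le_card (hsub b))
    -- the budget leaves no room for more than one code set in each block
    have hsum : ∑ b : Fin (φ.blocks g), h = ∑ b, (Finset.univ.filter fun x => (b, x) ∈ Y).card := by
      refine le_antisymm (Finset.sum_le_sum hle) ?_
      rw [← card_eq_sum_block]
      simpa using hY
    have heq := (Finset.sum_eq_sum_iff_of_le hle).mp hsum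
    have hmem : ∀ b (x : Fin (2 * h)), (b, x) ∈ Y → code.mem (τ b) x = true := by
      intro b x hx
      have := Finset.eq_of_subset_of_card_le (hsub b)
        (by rw [← heq b (Finset.mem_univ b), code.card _ (hτ b)])
      have hx' : x ∈ Finset.univ.filter fun x => (b, x) ∈ Y := by simpa using hx
      rw [← this] at hx'
      simpa using hx'
    -- hence no gadget is served by a slot that requires the whole modulator
    have hne : ∃ p, p ∉ Y := by
      by_contra! hall
      have : Y = Finset.univ := Finset.eq_univ_iff_forall.mpr hall
      rw [this, Finset.card_univ] at hY
      simp only [Fintype.card_prod, Fintype.card_fin] at hY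
      have := Nat.le_of_mul_le_mul_left hY (Nat.succ_pos _)
      omega
    obtain ⟨p, hp⟩ := hne
    refine ⟨fun i => (τ ⟨i / g, hdiv i⟩).testBit (i % g), fun c hc => ?_⟩
    obtain ⟨n, hn, rfl⟩ := List.mem_iff_getElem.mp hc
    obtain ⟨⟨j, τ'⟩, hw⟩ := hcov (.inl ⟨n, hn⟩)
    rcases hj : (φ.clauses[n])[(j : ℕ)]? with _ | l
    · refine absurd (hw p ?_) hp
      intro l hl
      simp [hj] at hl
    · refine ⟨l, List.mem_of_getElem? hj, ?_⟩
      have hτ' : (τ' : ℕ).testBit (l.1 % g) = l.2 := by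
        by_contra hneq
        refine absurd (hw p ?_) hp
        intro l' hl' h'
        simp only [List.get_eq_getElem, hj, Option.mem_def, Option.some.injEq] at hl'
        subst hl'
        exact absurd h' hneq
      have : (τ' : ℕ) = τ ⟨l.1 / g, hdiv l.1⟩ := by
        refine code.inj _ τ'.2 _ (hτ _) fun x hx hmx => ?_
        refine hmem ⟨l.1 / g, hdiv l.1⟩ ⟨x, hx⟩ (hw _ ?_)
        intro l' hl' h'
        simp only [List.get_eq_getElem, hj, Option.mem_def, Option.some.injEq] at hl'
        subst hl'
        exact ⟨rfl, hmx⟩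
      beta_reduce
      rw [← this, hτ']

end CNFFormula

/-! ### The reduction as a map of instances -/

theorem SimpleGraph.IsChordal.of_embedding {V V' : Type*} {G : SimpleGraph V}
    {G' : SimpleGraph V'} (h : G'.IsChordal) (f : G ↪g G') : G.IsChordal :=
  fun m hm => ⟨fun e => (h m hm).false (f.comp e)⟩

/-- Deleting vertices commutes with renaming them. -/
def SimpleGraph.minusComapIso {V V' : Type*} (e : V ≃ V') (G : SimpleGraph V') (X : Finset V) :
    (G.comap e).minus X ≃g G.minus (X.map e.toEmbedding) where
  toEquiv := e.subtypeEquiv fun v => by simp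
  map_rel_iff' := by simp

theorem Gadget.hitsTriangles_of_isBipartite {V : Type*} {G : SimpleGraph V} {X : Finset V}
    (h : (G.minus X).IsBipartite) : Gadget.HitsTriangles G X := by
  intro a b c hab hbc hac
  by_contra! hX
  exact h.no_triangle (a := ⟨a, by simpa using hX.1⟩) (b := ⟨b, by simpa using hX.2.1⟩)
    (c := ⟨c, by simpa using hX.2.2⟩) hab hbc hac

namespace CNFFormula

variable {g h : ℕ} (code : BalancedCode g h) (q : ℕ) (φ : CNFFormula)

/-- The size of the modulator. -/
def modulatorSize (h g : ℕ) (φ : CNFFormula) : ℕ := φ.blocks g * (2 * h)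

/-- The number of slots of a gadget. -/
def slots (g q : ℕ) : ℕ := (q + 1) * 2 ^ g

/-- The number of vertices of a gadget outside the modulator. -/
def gadgetSize (h g q : ℕ) (φ : CNFFormula) : ℕ :=
  slots g q + (2 + slots g q * φ.modulatorSize h g)

/-- The number of gadgets, counting copies. -/
def gadgets (h g : ℕ) (φ : CNFFormula) : ℕ :=
  (φ.clauses.length + φ.blocks g) * φ.modulatorSize h g

/-- The number of vertices of the graph. -/
def vertices (h g q : ℕ) (φ : CNFFormula) : ℕ :=
  φ.modulatorSize h g + φ.gadgets h g * φ.gadgetSize h g q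

/-- The bound on the size of a solution. -/
def budget (h g q : ℕ) (φ : CNFFormula) : ℕ :=
  φ.blocks g * h + φ.gadgets h g * (slots g q - 1)

/-- The vertices of the gadget graph of a formula.  The last index of a gadget numbers the
copies. -/
abbrev Vertex (h g q : ℕ) (φ : CNFFormula) : Type :=
  GadgetVertex (Fin (φ.blocks g) × Fin (2 * h))
    ((Fin φ.clauses.length ⊕ Fin (φ.blocks g)) × Fin (φ.modulatorSize h g))
    (Fin (q + 1) × Fin (2 ^ g))

/-- The gadget graph of a formula. -/
def gadgetGraph : SimpleGraph (φ.Vertex h g q) :=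
  Gadget.graph fun γ => φ.Requires code q γ.1

/-- The numbering of the vertices: the modulator comes first, and then one gadget after the other,
each with its slots, its apices and its pendant vertices in this order. -/
def vertexEquiv (h g q : ℕ) (φ : CNFFormula) : φ.Vertex h g q ≃ Fin (φ.vertices h g q) :=
  (Equiv.sumCongr finProdFinEquiv
    ((Equiv.prodCongr
      ((Equiv.prodCongr finSumFinEquiv (Equiv.refl _)).trans finProdFinEquiv)
      ((Equiv.sumCongr finProdFinEquiv
        ((Equiv.sumCongr (Equiv.refl _)
          ((Equiv.prodCongr finProdFinEquiv finProdFinEquiv).trans finProdFinEquiv)).trans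
            finSumFinEquiv)).trans finSumFinEquiv)).trans finProdFinEquiv)).trans finSumFinEquiv

variable {φ}

theorem satisfiable_of_isBipartite (hg : 0 < g) (hh : 0 < h) {q : ℕ}
    (hq : ∀ c ∈ φ.clauses, c.length ≤ q) (X : Finset (φ.Vertex h g q))
    (hX : X.card ≤ φ.budget h g q) (hb : ((φ.gadgetGraph code q).minus X).IsBipartite) :
    φ.Satisfiable := by
  rw [φ.satisfiable_iff_exists_cover code hg hh hq]
  refine Gadget.exists_cover (K := Fin (φ.modulatorSize h g)) (φ.Requires code q) _ ?_ X
    (Gadget.hitsTriangles_of_isBipartite hb) (hX.trans (le_of_eq ?_))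
  · rw [Fintype.card_fin]
    have : 0 < φ.blocks g := Nat.succ_pos _
    exact Nat.mul_lt_mul_of_pos_left (by omega) this
  · simp [budget, gadgets, slots]

theorem exists_isAcyclic_of_satisfiable (hg : 0 < g) (hh : 0 < h) {q : ℕ}
    (hq : ∀ c ∈ φ.clauses, c.length ≤ q) (hs : φ.Satisfiable) :
    ∃ X : Finset (φ.Vertex h g q), X.card ≤ φ.budget h g q ∧
      ((φ.gadgetGraph code q).minus X).IsAcyclic := by
  rw [φ.satisfiable_iff_exists_cover code hg hh hq] at hs
  obtain ⟨Y, hY, hcov⟩ := hs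
  obtain ⟨X, hX, hac⟩ := Gadget.exists_deletion
    (fun γ : _ × Fin (φ.modulatorSize h g) => φ.Requires code q γ.1) Y fun γ => hcov γ.1
  refine ⟨X, hX.trans ?_, hac⟩
  simpa [budget, gadgets, slots] using hY

variable (φ)

theorem vertexEquiv_inl (b : Fin (φ.blocks g)) (x : Fin (2 * h)) :
    (φ.vertexEquiv h g q (.inl (b, x)) : ℕ) = x + 2 * h * b := rfl

/-- The number of a gadget, apart from its copies. -/
def gadgetIndex : Fin φ.clauses.length ⊕ Fin (φ.blocks g) → ℕ
  | .inl c => c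
  | .inr b => φ.clauses.length + b

/-- The position of a vertex in its gadget. -/
def innerIndex : (Fin (q + 1) × Fin (2 ^ g)) ⊕ (Fin 2 ⊕ ((Fin (q + 1) × Fin (2 ^ g)) ×
    (Fin (φ.blocks g) × Fin (2 * h)))) → ℕ
  | .inl (j, τ) => τ + 2 ^ g * j
  | .inr (.inl i) => slots g q + i
  | .inr (.inr ((j, τ), (b, x))) =>
    slots g q + (2 + ((x + 2 * h * b) + φ.modulatorSize h g * (τ + 2 ^ g * j)))

theorem vertexEquiv_inr (c : Fin φ.clauses.length ⊕ Fin (φ.blocks g))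
    (i : Fin (φ.modulatorSize h g)) (r) :
    (φ.vertexEquiv h g q (.inr ((c, i), r)) : ℕ) = φ.modulatorSize h g +
      (φ.innerIndex q r + φ.gadgetSize h g q * (i + φ.modulatorSize h g * φ.gadgetIndex c)) := by
  rcases c with c | b <;> rcases r with ⟨j, τ⟩ | a | ⟨⟨j, τ⟩, ⟨b, x⟩⟩ <;> rfl

theorem innerIndex_lt (r) : φ.innerIndex (g := g) (h := h) q r < φ.gadgetSize h g q :=
  Fin.is_lt (((Equiv.sumCongr finProdFinEquiv
        ((Equiv.sumCongr (Equiv.refl _)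
          ((Equiv.prodCongr finProdFinEquiv finProdFinEquiv).trans finProdFinEquiv)).trans
            finSumFinEquiv)).trans finSumFinEquiv) r : Fin (φ.gadgetSize h g q)) |>.trans_eq'
    (by rcases r with ⟨j, τ⟩ | a | ⟨⟨j, τ⟩, ⟨b, x⟩⟩ <;> rfl)

theorem modulatorSize_le_vertices : φ.modulatorSize h g ≤ φ.vertices h g q :=
  Nat.le_add_right _ _

/-- The instance of the graph problems that belongs to a formula. -/
def toCVD : CVDInstance where
  n := φ.vertices h g q
  G := (φ.gadgetGraph code q).comap (φ.vertexEquiv h g q).symm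
  k := φ.modulatorSize h g
  ℓ := φ.budget h g q
  S := Finset.univ.filter fun v => (v : ℕ) < φ.modulatorSize h g
  card_S := by
    rw [Fin.card_filter_val_lt, min_eq_right (φ.modulatorSize_le_vertices q)]
  isCVD := by
    refine SimpleGraph.IsChordal.of_embedding ?_
      (SimpleGraph.minusComapIso (φ.vertexEquiv h g q).symm (φ.gadgetGraph code q) _).toEmbedding
    refine Gadget.chordal _ _ ?_
    rintro ⟨b, x⟩
    rw [Finset.mem_map_equiv, Equiv.symm_symm, Finset.mem_filter]
    exact ⟨Finset.mem_univ _, (finProdFinEquiv (b, x)).2⟩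

variable {φ q}

theorem isYes_FVS_iff (hg : 0 < g) (hh : 0 < h) (hq : ∀ c ∈ φ.clauses, c.length ≤ q) :
    FVSbyCVD.IsYes (φ.toCVD code q) ↔ φ.Satisfiable := by
  constructor
  · rintro ⟨X, hX, hac⟩
    have hac' := (SimpleGraph.minusComapIso (φ.vertexEquiv h g q).symm _ X).isAcyclic_iff.mp hac
    exact φ.satisfiable_of_isBipartite code hg hh hq _ ((Finset.card_map _).trans_le hX)
      hac'.isBipartite
  · intro hs
    obtain ⟨X, hX, hac⟩ := φ.exists_isAcyclic_of_satisfiable code hg hh hq hs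
    refine ⟨X.map (φ.vertexEquiv h g q).toEmbedding, (Finset.card_map _).trans_le hX, ?_⟩
    refine (SimpleGraph.minusComapIso (φ.vertexEquiv h g q).symm _ _).isAcyclic_iff.mpr ?_
    have hXX : (X.map (φ.vertexEquiv h g q).toEmbedding).map
        (φ.vertexEquiv h g q).symm.toEmbedding = X := by
      ext v; simp
    have key : ((φ.gadgetGraph code q).minus ((X.map (φ.vertexEquiv h g q).toEmbedding).map
        (φ.vertexEquiv h g q).symm.toEmbedding)).IsAcyclic := by
      rw [hXX]; exact hac
    exact key

theorem isYes_OCT_iff (hg : 0 < g) (hh : 0 < h) (hq : ∀ c ∈ φ.clauses, c.length ≤ q) :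
    OCTbyCVD.IsYes (φ.toCVD code q) ↔ φ.Satisfiable := by
  constructor
  · rintro ⟨X, hX, hb⟩
    have hb' := hb.of_hom
      (SimpleGraph.minusComapIso (φ.vertexEquiv h g q).symm _ X).symm.toHom
    exact φ.satisfiable_of_isBipartite code hg hh hq _ ((Finset.card_map _).trans_le hX) hb'
  · intro hs
    obtain ⟨X, hX, hac⟩ := (isYes_FVS_iff code hg hh hq).mpr hs
    exact ⟨X, hX, hac.isBipartite⟩

end CNFFormula

open Classical in
/-- The number in cell `t` of the input word of an instance of the graph problems. -/
theorem CVDInstance.getD_encode (I : CVDInstance) (t : ℕ) : I.encode.getD t 0 =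
    if t = 0 then I.n else if t = 1 then I.k else if t = 2 then I.ℓ
    else if ht : t - 3 < I.n * I.n then
      if I.G.Adj ⟨(t - 3) / I.n, Nat.div_lt_of_lt_mul ht⟩
        ⟨(t - 3) % I.n, Nat.mod_lt _ (Nat.pos_of_mul_pos_left (Nat.zero_lt_of_lt ht))⟩
      then 1 else 0
    else if ht : t - 3 - I.n * I.n < I.n then if ⟨t - 3 - I.n * I.n, ht⟩ ∈ I.S then 1 else 0
    else 0 := by
  have hmat : ((List.finRange I.n).flatMap fun u =>
      (List.finRange I.n).map fun v => if I.G.Adj u v then 1 else 0) =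
      List.ofFn fun z : Fin (I.n * I.n) =>
        if I.G.Adj ⟨z / I.n, Nat.div_lt_of_lt_mul z.2⟩
          ⟨z % I.n, Nat.mod_lt _ (Nat.pos_of_mul_pos_left (Nat.zero_lt_of_lt z.2))⟩
        then 1 else 0 := by
    rw [List.ofFn_mul, List.flatMap_def, List.ofFn_eq_map]
    congr 1
    refine List.map_congr_left fun u _ => ?_
    rw [List.ofFn_eq_map]
    refine List.map_congr_left fun v _ => ?_
    have h1 : ((u : ℕ) * I.n + v) / I.n = u := by
      rw [mul_comm, Nat.mul_add_div (Nat.zero_lt_of_lt v.2), Nat.div_eq_of_lt v.2, add_zero]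
    have h2 : ((u : ℕ) * I.n + v) % I.n = v := by
      rw [mul_comm, Nat.mul_add_mod, Nat.mod_eq_of_lt v.2]
    simp only [h1, h2]
  have hS : ((List.finRange I.n).map fun v => if v ∈ I.S then 1 else 0) =
      List.ofFn fun v => if v ∈ I.S then 1 else 0 := List.ofFn_eq_map.symm
  rw [CVDInstance.encode, hmat, hS]
  match t with
  | 0 => simp
  | 1 => simp
  | 2 => simp
  | t + 3 =>
    simp only [List.cons_append, List.nil_append, List.getD_cons_succ, Nat.add_sub_cancel]
    rw [if_neg (by omega), if_neg (by omega), if_neg (by omega)]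
    by_cases h1 : t < I.n * I.n
    · rw [dif_pos h1, List.getD_append _ _ _ _ (by simpa using h1),
        List.getD_eq_getElem _ _ (by simpa using h1), List.getElem_ofFn]
    · rw [dif_neg h1, List.getD_append_right _ _ _ _ (by simpa using h1), List.length_ofFn]
      by_cases h2 : t - I.n * I.n < I.n
      · rw [dif_pos h2, List.getD_eq_getElem _ _ (by simpa using h2), List.getElem_ofFn]
      · rw [dif_neg h2, List.getD_eq_default _ _ (by simpa using h2)]

theorem CVDInstance.length_encode (I : CVDInstance) :
    I.encode.length = 3 + I.n * I.n + I.n := by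
  simp [CVDInstance.encode]
  omega

/-! ### Reading a formula from its input word -/

namespace CNFFormula

/-- The position at which clause `c` begins in an input word. -/
def clausePos (w : List ℕ) : ℕ → ℕ
  | 0 => 2
  | c + 1 => clausePos w c + 1 + w.getD (clausePos w c) 0

/-- The part of the input word that belongs to a clause. -/
def encodeClause {n : ℕ} (c : List (Fin n × Bool)) : List ℕ :=
  c.length :: c.map fun l => 2 * (l.1 : ℕ) + l.2.toNat

variable (φ : CNFFormula)

theorem getD_of_drop {w l : List ℕ} {p : ℕ} (h : w.drop p = l) (j : ℕ) :
    w.getD (p + j) 0 = l.getD j 0 := by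
  simp [← h, List.getD_eq_getElem?_getD]

theorem drop_clausePos {c : ℕ} (hc : c ≤ φ.clauses.length) :
    φ.encode.drop (clausePos φ.encode c) = (φ.clauses.drop c).flatMap encodeClause := by
  induction c with
  | zero => rfl
  | succ c ih =>
    have ih := ih (by omega)
    rw [List.drop_eq_getElem_cons (l := φ.clauses) (by omega), List.flatMap_cons, encodeClause,
      List.cons_append] at ih
    have hlen : φ.encode.getD (clausePos φ.encode c) 0 = (φ.clauses[c]).length := by
      simpa using getD_of_drop ih 0
    rw [clausePos, hlen, add_assoc, ← List.drop_drop, ih, Nat.add_comm 1, List.drop_succ_cons,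
      List.drop_append_of_le_length (by simp), List.drop_of_length_le (by simp), List.nil_append]

theorem drop_clausePos_eq_cons {c : ℕ} (hc : c < φ.clauses.length) :
    φ.encode.drop (clausePos φ.encode c) = (φ.clauses[c]).length ::
      ((φ.clauses[c]).map (fun l => 2 * (l.1 : ℕ) + l.2.toNat) ++
        (φ.clauses.drop (c + 1)).flatMap encodeClause) := by
  rw [φ.drop_clausePos hc.le, List.drop_eq_getElem_cons hc]
  rfl

theorem getD_clausePos {c : ℕ} (hc : c < φ.clauses.length) :
    φ.encode.getD (clausePos φ.encode c) 0 = (φ.clauses[c]).length := by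
  simpa using getD_of_drop (φ.drop_clausePos_eq_cons hc) 0

theorem getD_literal {c j : ℕ} (hc : c < φ.clauses.length) (hj : j < (φ.clauses[c]).length) :
    φ.encode.getD (clausePos φ.encode c + 1 + j) 0 =
      2 * ((φ.clauses[c])[j].1 : ℕ) + (φ.clauses[c])[j].2.toNat := by
  rw [add_assoc, getD_of_drop (φ.drop_clausePos_eq_cons hc), Nat.add_comm 1, List.getD_cons_succ,
    List.getD_append _ _ _ _ (by simpa using hj), List.getD_eq_getElem _ _ (by simpa using hj)]
  simp

theorem clausePos_le {c : ℕ} (hc : c ≤ φ.clauses.length) :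
    clausePos φ.encode c ≤ φ.encode.length := by
  induction c with
  | zero => simp [clausePos, encode]
  | succ c ih =>
    have h := congrArg List.length (φ.drop_clausePos_eq_cons (c := c) (by omega))
    simp only [List.length_drop, List.length_cons, List.length_append, List.length_map] at h
    rw [clausePos, φ.getD_clausePos (by omega)]
    omega

end CNFFormula

/-! ### The expression for the cells of the output -/

namespace CNFFormula

open RAM Expr

variable {g h : ℕ} (code : BalancedCode g h) (q : ℕ)

/-- The values of a Boolean function below `n`, as a table. -/
def table (f : ℕ → Bool) (n : ℕ) : List ℕ := (List.range n).map fun z => (f z).toNat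

theorem getD_table {f : ℕ → Bool} {n z : ℕ} (hz : z < n) :
    (table f n).getD z 0 = if f z = true then 1 else 0 := by
  rw [List.getD_eq_getElem _ _ (by simpa [table] using hz)]
  simp only [table, List.getElem_map, List.getElem_range]
  cases f z <;> rfl

/-- The table of the code sets. -/
def codeTable : List ℕ := table (fun z => code.mem (z / (2 * h)) (z % (2 * h))) (2 ^ g * (2 * h))

/-- The table that tells whether a literal is true under an assignment of its block. -/
def trueTable (g : ℕ) : List ℕ :=
  table (fun z => decide ((z / (2 * g)).testBit (z % (2 * g) / 2) = decide (z % 2 = 1)))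
    (2 ^ g * (2 * g))

/-- `1` if slot `s` of a gadget of type `c` requires the deletion of vertex `x` of the modulator,
and `0` otherwise.  The number of clauses is in register `3`, the input word in array `1`, and the
positions of the clauses are in array `2`. -/
def requiresExpr (c s x : Expr) : Expr :=
  let b := div x (const (2 * h))
  let inCode := tbl (codeTable code)
    (add (mul (mod s (const (2 ^ g))) (const (2 * h))) (mod x (const (2 * h))))
  let j := div s (const (2 ^ g))
  let lit := arr 1 (add (add (arr 2 c) (const 1)) j)
  ite (lt c (var 3))
    (ite (lt j (arr 1 (arr 2 c)))
      (ite (tbl (trueTable g)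
          (add (mul (mod s (const (2 ^ g))) (const (2 * g))) (mod lit (const (2 * g)))))
        (ite (eq b (div lit (const (2 * g)))) inCode (const 0))
        (const 1))
      (const 1))
    (ite (eq b (sub c (var 3))) inCode (const 0))

/-- `1` if `Gadget.edge` holds for the vertices with numbers `u` and `v`, and `0` otherwise.  The
sizes of the modulator and of a gadget are in the registers `5` and `6`. -/
def edgeExpr (u v : Expr) : Expr :=
  let M := slots g q
  let γ := fun e : Expr => div (sub e (var 5)) (var 6)
  let r := fun e : Expr => mod (sub e (var 5)) (var 6)
  let y := sub (r u) (const (M + 2))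
  ite (lt u (var 5)) (const 0) <|
  ite (lt (r u) (const M))
    (ite (lt v (var 5)) (requiresExpr code (div (γ u) (var 5)) (r u) v) <|
      ite (eq (γ u) (γ v))
        (ite (lt (r v) (const M)) (ite (eq (r u) (r v)) (const 0) (const 1)) <|
          ite (lt (r v) (const (M + 2))) (const 1)
            (eq (r u) (div (sub (r v) (const (M + 2))) (var 5))))
        (const 0)) <|
  ite (lt (r u) (const (M + 2))) (const 0)
    (ite (eq (mod y (var 5)) v) (requiresExpr code (div (γ u) (var 5)) (div y (var 5)) v)
      (const 0))

/-- The content of the output cell whose number is in register `1`.  The number of vertices, the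
size of the modulator and the budget are in the registers `7`, `5` and `8`. -/
def cellExpr : Expr :=
  let t := sub (var 1) (const 3)
  let n2 := mul (var 7) (var 7)
  let u := div t (var 7)
  let v := mod t (var 7)
  ite (lt (var 1) (const 3))
    (ite (eq (var 1) (const 0)) (var 7) (ite (eq (var 1) (const 1)) (var 5) (var 8))) <|
  ite (lt t n2)
    (ite (add (edgeExpr code q u v) (edgeExpr code q v u)) (const 1) (const 0))
    (lt (sub t n2) (var 5))

/-- The memory holds the data that `cellExpr` relies on. -/
structure Ready (h g q : ℕ) (φ : CNFFormula) (s : State) : Prop where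
  word : ∀ j, s.arr 1 j = φ.encode.getD j 0
  pos : ∀ c < φ.clauses.length, s.arr 2 c = clausePos φ.encode c
  clauses : s.reg 3 = φ.clauses.length
  modulator : s.reg 5 = φ.modulatorSize h g
  gadget : s.reg 6 = φ.gadgetSize h g q
  vertices : s.reg 7 = φ.vertices h g q
  budget : s.reg 8 = φ.budget h g q

variable {code q} {φ : CNFFormula} {s : State}

theorem eval_const (c : ℕ) (s : State) : (const c).eval s = c := rfl

theorem eval_var (i : ℕ) (s : State) : (var i).eval s = s.reg i := rfl

theorem eval_add (e f : Expr) (s : State) : (add e f).eval s = e.eval s + f.eval s := rfl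

theorem eval_ite (c e f : Expr) (s : State) :
    (ite c e f).eval s = if c.eval s ≠ 0 then e.eval s else f.eval s := rfl

open Classical in
theorem eval_requiresExpr (hg : 0 < g) (hh : 0 < h) (hs : φ.Ready h g q s)
    {ec es ex : Expr} (c : Fin φ.clauses.length ⊕ Fin (φ.blocks g))
    (j : Fin (q + 1)) (τ : Fin (2 ^ g)) (b : Fin (φ.blocks g)) (x : Fin (2 * h))
    (hc : ec.eval s = φ.gadgetIndex c) (hw : es.eval s = τ + 2 ^ g * j)
    (hx : ex.eval s = x + 2 * h * b) :
    (requiresExpr code ec es ex).eval s =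
      if φ.Requires code q c (j, τ) (b, x) then 1 else 0 := by
  have hτ := τ.2
  have hx2 := x.2
  have h1 : ex.eval s / (2 * h) = b := by
    rw [hx, Nat.add_mul_div_left _ _ (by omega), Nat.div_eq_of_lt hx2, zero_add]
  have h2 : ex.eval s % (2 * h) = x := by
    rw [hx, Nat.add_mul_mod_self_left, Nat.mod_eq_of_lt hx2]
  have h3 : es.eval s / 2 ^ g = j := by
    rw [hw, Nat.add_mul_div_left _ _ (by positivity), Nat.div_eq_of_lt hτ, zero_add]
  have h4 : es.eval s % 2 ^ g = τ := by
    rw [hw, Nat.add_mul_mod_self_left, Nat.mod_eq_of_lt hτ]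
  have hcode : (codeTable code).getD (τ * (2 * h) + x) 0 =
      if code.mem τ x = true then 1 else 0 := by
    have hlt : (τ : ℕ) * (2 * h) + x < 2 ^ g * (2 * h) := by
      have : ((τ : ℕ) + 1) * (2 * h) ≤ 2 ^ g * (2 * h) := Nat.mul_le_mul_right _ hτ
      rw [add_mul] at this
      omega
    rw [codeTable, getD_table hlt, mul_comm, Nat.mul_add_div (by omega), Nat.div_eq_of_lt hx2,
      add_zero, Nat.mul_add_mod, Nat.mod_eq_of_lt hx2]
  have htrue : ∀ (i : ℕ) (v : Bool), (trueTable g).getD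
      (τ * (2 * g) + (2 * i + v.toNat) % (2 * g)) 0 =
      if (τ : ℕ).testBit (i % g) = v then 1 else 0 := by
    intro i v
    have hv : v.toNat < 2 := by cases v <;> simp
    have hm : (2 * i + v.toNat) % (2 * g) = 2 * (i % g) + v.toNat := by
      have hlt := Nat.mod_lt i hg
      conv_lhs => rw [← Nat.div_add_mod i g]
      rw [mul_add, ← mul_assoc, add_assoc, Nat.mul_add_mod, Nat.mod_eq_of_lt (by omega)]
    have hr := Nat.mod_lt i hg
    rw [hm]
    generalize i % g = r at *
    have hlt : (τ : ℕ) * (2 * g) + (2 * r + v.toNat) < 2 ^ g * (2 * g) := by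
      have : ((τ : ℕ) + 1) * (2 * g) ≤ 2 ^ g * (2 * g) := Nat.mul_le_mul_right _ hτ
      rw [add_mul] at this
      omega
    have e1 : ((τ : ℕ) * (2 * g) + (2 * r + v.toNat)) / (2 * g) = τ := by
      rw [mul_comm, Nat.mul_add_div (by omega), Nat.div_eq_of_lt (by omega), add_zero]
    have e2 : ((τ : ℕ) * (2 * g) + (2 * r + v.toNat)) % (2 * g) = 2 * r + v.toNat := by
      rw [mul_comm, Nat.mul_add_mod, Nat.mod_eq_of_lt (by omega)]
    have e3 : (2 * r + v.toNat) / 2 = r := by omega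
    have e4 : ((τ : ℕ) * (2 * g) + (2 * r + v.toNat)) % 2 = v.toNat := by
      rw [mul_left_comm, ← add_assoc, ← mul_add, Nat.mul_add_mod]
      omega
    rw [trueTable, getD_table hlt, e1, e2, e3, e4]
    cases v <;> simp
  have hlit : ∀ (i : ℕ) (v : Bool), (2 * i + v.toNat) / (2 * g) = i / g := by
    intro i v
    have hv : v.toNat < 2 := by cases v <;> simp
    rw [← Nat.div_div_eq_div_mul, Nat.mul_add_div (by omega), Nat.div_eq_of_lt hv, add_zero]
  rcases c with c | b'
  · have hc' : ec.eval s < φ.clauses.length := by rw [hc]; exact c.2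
    have hcc : ec.eval s = c := hc
    have hpos := hs.pos _ hc'
    simp only [requiresExpr, eval, eval_lt, eval_eq, eval_mod, h1, h2, h3, h4, hs.clauses, hc',
      hpos, hs.word, hcode]
    rw [hcc, φ.getD_clausePos c.2]
    by_cases hj : (j : ℕ) < (φ.clauses[(c : ℕ)]).length
    · rw [φ.getD_literal c.2 hj, htrue, hlit]
      simp only [Requires, List.get_eq_getElem, List.getElem?_eq_getElem hj, Option.mem_def,
        Option.some.injEq, forall_eq', hj]
      generalize φ.clauses[(c : ℕ)][(j : ℕ)] = l
      by_cases hl : (τ : ℕ).testBit (l.1 % g) = l.2 <;> by_cases hb : (b : ℕ) = l.1 / g <;>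
        by_cases hm : code.mem τ x = true <;> simp [hl, hb, hm]
    · have : (φ.clauses[(c : ℕ)])[(j : ℕ)]? = none := List.getElem?_eq_none (by omega)
      simp [Requires, hj]
  · have hc' : ¬ ec.eval s < φ.clauses.length := by
      rw [hc, gadgetIndex]; omega
    have hcc : ec.eval s - φ.clauses.length = b' := by
      rw [hc, gadgetIndex]; omega
    have hreq : φ.Requires code q (.inr b') (j, τ) (b, x) ↔ b = b' ∧ code.mem τ x = true := Iff.rfl
    simp only [requiresExpr, eval, eval_lt, eval_eq, eval_mod, h1, h2, h4, hs.clauses, hc',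
      hcc, hcode, hreq, Fin.ext_iff]
    by_cases hb : (b : ℕ) = b' <;> by_cases hm : code.mem τ x = true <;> simp [hb, hm]

end CNFFormula

namespace CNFFormula

open RAM Expr

variable {g h : ℕ} {code : BalancedCode g h} {q : ℕ} {φ : CNFFormula} {s : State}

theorem modulatorSize_pos (hh : 0 < h) : 0 < φ.modulatorSize h g :=
  Nat.mul_pos (Nat.succ_pos _) (by omega)

theorem gadgetIndex_injective : Function.Injective (φ.gadgetIndex (g := g)) := by
  rintro (c | b) (c' | b') hcc
  · exact congrArg Sum.inl (Fin.ext hcc)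
  · simp only [gadgetIndex] at hcc; omega
  · simp only [gadgetIndex] at hcc; omega
  · simp only [gadgetIndex] at hcc; exact congrArg Sum.inr (Fin.ext (by omega))

theorem vertexEquiv_inl_lt (p : Fin (φ.blocks g) × Fin (2 * h)) :
    (φ.vertexEquiv h g q (.inl p) : ℕ) < φ.modulatorSize h g :=
  (finProdFinEquiv p).2

theorem vertexEquiv_inr_decode (hh : 0 < h) {c : Fin φ.clauses.length ⊕ Fin (φ.blocks g)}
    {i : Fin (φ.modulatorSize h g)} {r} {v : ℕ}
    (hv : v = φ.vertexEquiv h g q (.inr ((c, i), r))) :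
    ¬ v < φ.modulatorSize h g ∧
    (v - φ.modulatorSize h g) / φ.gadgetSize h g q =
      i + φ.modulatorSize h g * φ.gadgetIndex c ∧
    (v - φ.modulatorSize h g) / φ.gadgetSize h g q / φ.modulatorSize h g = φ.gadgetIndex c ∧
    (v - φ.modulatorSize h g) % φ.gadgetSize h g q = φ.innerIndex q r := by
  have hlt := φ.innerIndex_lt (g := g) (h := h) q r
  rw [vertexEquiv_inr] at hv
  have h1 : v - φ.modulatorSize h g = φ.innerIndex q r + φ.gadgetSize h g q *
      (i + φ.modulatorSize h g * φ.gadgetIndex c) := by omega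
  have h2 : (v - φ.modulatorSize h g) / φ.gadgetSize h g q =
      i + φ.modulatorSize h g * φ.gadgetIndex c := by
    rw [h1, Nat.add_mul_div_left _ _ (by omega), Nat.div_eq_of_lt hlt, zero_add]
  refine ⟨by omega, h2, ?_, ?_⟩
  · rw [h2, Nat.add_mul_div_left _ _ (modulatorSize_pos hh), Nat.div_eq_of_lt i.2, zero_add]
  · rw [h1, Nat.add_mul_mod_self_left, Nat.mod_eq_of_lt hlt]

theorem gadgetNumber_inj {c c' : Fin φ.clauses.length ⊕ Fin (φ.blocks g)}
    {i i' : Fin (φ.modulatorSize h g)} :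
    i + φ.modulatorSize h g * φ.gadgetIndex c = i' + φ.modulatorSize h g * φ.gadgetIndex c' ↔
      (c, i) = (c', i') := by
  constructor
  · intro hcc
    have h1 := congrArg (· / φ.modulatorSize h g) hcc
    have h2 := congrArg (· % φ.modulatorSize h g) hcc
    have hpos : 0 < φ.modulatorSize h g := Nat.zero_lt_of_lt i.2
    simp only [Nat.add_mul_div_left _ _ hpos, Nat.div_eq_of_lt i.2, Nat.div_eq_of_lt i'.2,
      zero_add] at h1
    simp only [Nat.add_mul_mod_self_left, Nat.mod_eq_of_lt i.2, Nat.mod_eq_of_lt i'.2] at h2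
    exact Prod.ext (gadgetIndex_injective h1) (Fin.ext h2)
  · intro hcc
    simp only [Prod.mk.injEq] at hcc
    rw [hcc.1, hcc.2]

theorem slotNumber_lt (j : Fin (q + 1)) (τ : Fin (2 ^ g)) : (τ : ℕ) + 2 ^ g * j < slots g q :=
  (finProdFinEquiv (j, τ)).2

theorem slotNumber_inj {j j' : Fin (q + 1)} {τ τ' : Fin (2 ^ g)} :
    (τ : ℕ) + 2 ^ g * j = τ' + 2 ^ g * j' ↔ (j, τ) = (j', τ') := by
  rw [← finProdFinEquiv.injective.eq_iff, Fin.ext_iff]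
  rfl

theorem modulatorNumber_inj {b b' : Fin (φ.blocks g)} {x x' : Fin (2 * h)} :
    (x : ℕ) + 2 * h * b = x' + 2 * h * b' ↔ (b, x) = (b', x') := by
  rw [← finProdFinEquiv.injective.eq_iff, Fin.ext_iff]
  rfl

open Classical in
theorem eval_edgeExpr (hg : 0 < g) (hh : 0 < h) (hs : φ.Ready h g q s) {eu ev : Expr}
    (u v : φ.Vertex h g q) (hu : eu.eval s = φ.vertexEquiv h g q u)
    (hv : ev.eval s = φ.vertexEquiv h g q v) :
    (edgeExpr code q eu ev).eval s =
      if Gadget.edge (fun γ => φ.Requires code q γ.1) u v then 1 else 0 := by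
  have hpos := φ.modulatorSize_pos (g := g) hh
  rcases u with ⟨b, x⟩ | ⟨⟨c, i⟩, r⟩
  · have hlt : eu.eval s < φ.modulatorSize h g := by rw [hu]; exact vertexEquiv_inl_lt _
    simp [edgeExpr, eval, hs.modulator, hlt, Gadget.edge]
  obtain ⟨u1, u2, u3, u4⟩ := vertexEquiv_inr_decode hh hu
  have hγ : (div (div (sub eu (var 5)) (var 6)) (var 5)).eval s = φ.gadgetIndex c := by
    simp only [eval, hs.modulator, hs.gadget, u3]
  have hr : (mod (sub eu (var 5)) (var 6)).eval s = φ.innerIndex q r := by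
    simp only [eval, eval_mod, hs.modulator, hs.gadget, u4]
  rcases r with ⟨j, τ⟩ | a | ⟨⟨j, τ⟩, ⟨b, x⟩⟩
  · have hsl := slotNumber_lt j τ
    rcases v with ⟨b', x'⟩ | ⟨⟨c', i'⟩, r'⟩
    · have hlt : ev.eval s < φ.modulatorSize h g := by rw [hv]; exact vertexEquiv_inl_lt _
      have hreq := eval_requiresExpr (code := code) hg hh hs c j τ b' x' hγ hr hv
      by_cases hR : φ.Requires code q c (j, τ) (b', x')
      · rw [if_pos hR] at hreq
        simp [edgeExpr, eval, hs.modulator, hs.gadget, u1, u4, hlt, hreq, innerIndex, hsl,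
          Gadget.edge, hR]
      · rw [if_neg hR] at hreq
        simp [edgeExpr, eval, hs.modulator, hs.gadget, u1, u4, hlt, hreq, innerIndex, hsl,
          Gadget.edge, hR]
    · obtain ⟨v1, v2, v3, v4⟩ := vertexEquiv_inr_decode hh hv
      simp only [edgeExpr, eval, eval_lt, eval_eq, eval_mod, hs.modulator, hs.gadget, u1, u2, u4,
        v1, v2, v4, innerIndex, hsl, gadgetNumber_inj]
      by_cases hcc : (c, i) = (c', i')
      · rcases r' with ⟨j', τ'⟩ | a | ⟨⟨j', τ'⟩, ⟨b', x'⟩⟩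
        · have hsl' := slotNumber_lt j' τ'
          by_cases hne : (j, τ) = (j', τ')
          · simp only [hcc, hsl', slotNumber_inj, hne, Gadget.edge]
            simp
          · simp only [hcc, hsl', slotNumber_inj, hne, Gadget.edge]
            simpa using hne
        · have ha : ¬ 1 < (a : ℕ) := by omega
          simp [hcc, Gadget.edge, ha]
        · have hx := vertexEquiv_inl_lt (q := q) (b', x')
          rw [vertexEquiv_inl] at hx
          have h1 : slots g q + (2 + (x' + 2 * h * b' + φ.modulatorSize h g * (τ' + 2 ^ g * j'))) -
              (slots g q + 2) = x' + 2 * h * b' + φ.modulatorSize h g * (τ' + 2 ^ g * j') := by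
            omega
          have h2 : (x' + 2 * h * b' + φ.modulatorSize h g * (τ' + 2 ^ g * j')) /
              φ.modulatorSize h g = τ' + 2 ^ g * j' := by
            rw [Nat.add_mul_div_left _ _ hpos, Nat.div_eq_of_lt hx, zero_add]
          have hle : ¬ slots g q + (2 + (x' + 2 * h * b' + φ.modulatorSize h g *
              (τ' + 2 ^ g * j'))) < slots g q := by omega
          have hle' : ¬ slots g q + (2 + (x' + 2 * h * b' + φ.modulatorSize h g *
              (τ' + 2 ^ g * j'))) < slots g q + 2 := by omega
          simp only [h1, h2, slotNumber_inj, hle, hle', hcc, Gadget.edge]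
          simp
      · rcases r' with ⟨j', τ'⟩ | a | ⟨⟨j', τ'⟩, ⟨b', x'⟩⟩ <;> simp [hcc, Gadget.edge]
  · have ha : ¬ 1 < (a : ℕ) := by omega
    rcases v with ⟨b', x'⟩ | ⟨⟨c', i'⟩, ⟨j', τ'⟩ | a' | ⟨⟨j', τ'⟩, ⟨b', x'⟩⟩⟩ <;>
      simp [edgeExpr, eval, hs.modulator, hs.gadget, u1, u4, innerIndex, Gadget.edge, ha]
  · have hx := vertexEquiv_inl_lt (q := q) (b, x)
    rw [vertexEquiv_inl] at hx
    have h1 : slots g q + (2 + (x + 2 * h * b + φ.modulatorSize h g * (τ + 2 ^ g * j))) -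
        (slots g q + 2) = x + 2 * h * b + φ.modulatorSize h g * (τ + 2 ^ g * j) := by
      omega
    have hle : ¬ slots g q + (2 + (x + 2 * h * b + φ.modulatorSize h g * (τ + 2 ^ g * j))) <
        slots g q := by omega
    have hle' : ¬ slots g q + (2 + (x + 2 * h * b + φ.modulatorSize h g * (τ + 2 ^ g * j))) <
        slots g q + 2 := by omega
    have hy : (sub (mod (sub eu (var 5)) (var 6)) (const (slots g q + 2))).eval s =
        x + 2 * h * b + φ.modulatorSize h g * (τ + 2 ^ g * j) := by
      rw [eval, hr]; exact h1
    have hy1 : (div (sub (mod (sub eu (var 5)) (var 6)) (const (slots g q + 2))) (var 5)).eval s =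
        τ + 2 ^ g * j := by
      rw [eval, hy, eval, hs.modulator, Nat.add_mul_div_left _ _ hpos, Nat.div_eq_of_lt hx,
        zero_add]
    have hy2 : (mod (sub (mod (sub eu (var 5)) (var 6)) (const (slots g q + 2))) (var 5)).eval s =
        x + 2 * h * b := by
      rw [eval_mod, hy, eval, hs.modulator, Nat.add_mul_mod_self_left, Nat.mod_eq_of_lt hx]
    rw [innerIndex] at hr
    have hedge : (edgeExpr code q eu ev).eval s =
        if x + 2 * h * b = ev.eval s then
          (requiresExpr code (div (div (sub eu (var 5)) (var 6)) (var 5))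
            (div (sub (mod (sub eu (var 5)) (var 6)) (const (slots g q + 2))) (var 5)) ev).eval s
        else 0 := by
      simp only [edgeExpr, eval_ite, eval_lt, eval_eq, hr, hy2, eval_const, eval_var,
        hs.modulator, u1, hle, hle']
      simp
    rw [hedge]
    rcases v with ⟨b', x'⟩ | ⟨⟨c', i'⟩, r'⟩
    · have hreq := eval_requiresExpr (code := code) hg hh hs c j τ b' x' hγ hy1 hv
      rw [hreq, hv, vertexEquiv_inl]
      simp only [modulatorNumber_inj]
      by_cases hxx : (b, x) = (b', x')
      · by_cases hR : φ.Requires code q c (j, τ) (b', x')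
        · simp [hxx, hR, Gadget.edge]
        · simp [hxx, hR, Gadget.edge]
      · simp [hxx, Gadget.edge]
    · obtain ⟨v1, -⟩ := vertexEquiv_inr_decode hh hv
      rw [if_neg (by omega)]
      rcases r' with ⟨j', τ'⟩ | a | ⟨⟨j', τ'⟩, ⟨b', x'⟩⟩ <;> simp [Gadget.edge]

theorem eval_cellExpr (hg : 0 < g) (hh : 0 < h) (hs : φ.Ready h g q s) {t : ℕ}
    (ht : s.reg 1 = t)
    (htL : t < 3 + φ.vertices h g q * φ.vertices h g q + φ.vertices h g q) :
    (cellExpr code q).eval s = (φ.toCVD code q).encode.getD t 0 := by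
  classical
  rw [CVDInstance.getD_encode]
  have hn : (φ.toCVD code q).n = φ.vertices h g q := rfl
  have hk : (φ.toCVD code q).k = φ.modulatorSize h g := rfl
  have hl : (φ.toCVD code q).ℓ = φ.budget h g q := rfl
  simp only [cellExpr, eval_ite, eval_lt, eval_eq, eval_const, eval_var, ht, hs.vertices,
    hs.modulator, hs.budget]
  by_cases h0 : t = 0
  · simp [h0, hn]
  by_cases h1 : t = 1
  · simp [h1, hk]
  by_cases h2 : t = 2
  · simp [h2, hl]
  have h3 : ¬ t < 3 := by omega
  have ht3 : (sub (var 1) (const 3)).eval s = t - 3 := by simp only [eval, ht]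
  have hnn : (mul (var 7) (var 7)).eval s = φ.vertices h g q * φ.vertices h g q := by
    simp only [eval, hs.vertices]
  simp only [h0, h1, h2, if_false, h3, ht3, hnn]
  by_cases hm : t - 3 < φ.vertices h g q * φ.vertices h g q
  · rw [dif_pos (show t - 3 < (φ.toCVD code q).n * (φ.toCVD code q).n from hm)]
    set u : Fin (φ.vertices h g q) := ⟨(t - 3) / φ.vertices h g q, Nat.div_lt_of_lt_mul hm⟩ with hu
    set v : Fin (φ.vertices h g q) := ⟨(t - 3) % φ.vertices h g q,
      Nat.mod_lt _ (Nat.pos_of_mul_pos_left (Nat.zero_lt_of_lt hm))⟩ with hv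
    have hadj : (φ.toCVD code q).G.Adj u v ↔
        Gadget.edge (fun γ => φ.Requires code q γ.1) ((φ.vertexEquiv h g q).symm u)
          ((φ.vertexEquiv h g q).symm v) ∨
        Gadget.edge (fun γ => φ.Requires code q γ.1) ((φ.vertexEquiv h g q).symm v)
          ((φ.vertexEquiv h g q).symm u) := Iff.rfl
    have eu : (div (sub (var 1) (const 3)) (var 7)).eval s =
        φ.vertexEquiv h g q ((φ.vertexEquiv h g q).symm u) := by
      rw [Equiv.apply_symm_apply]; simp only [eval, ht, hs.vertices, hu]
    have ev : (mod (sub (var 1) (const 3)) (var 7)).eval s =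
        φ.vertexEquiv h g q ((φ.vertexEquiv h g q).symm v) := by
      rw [Equiv.apply_symm_apply]; simp only [eval, eval_mod, ht, hs.vertices, hv]
    have e1 := eval_edgeExpr (code := code) hg hh hs _ _ eu ev
    have e2 := eval_edgeExpr (code := code) hg hh hs _ _ ev eu
    simp only [hm, if_true]
    by_cases hA : Gadget.edge (fun γ => φ.Requires code q γ.1)
        ((φ.vertexEquiv h g q).symm u) ((φ.vertexEquiv h g q).symm v)
    · refine Eq.trans ?_ (if_pos (hadj.mpr (Or.inl hA))).symm
      simp [eval_add, e1, hA]
    by_cases hB : Gadget.edge (fun γ => φ.Requires code q γ.1)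
        ((φ.vertexEquiv h g q).symm v) ((φ.vertexEquiv h g q).symm u)
    · refine Eq.trans ?_ (if_pos (hadj.mpr (Or.inr hB))).symm
      simp [eval_add, e2, hB]
    · refine Eq.trans ?_ (if_neg (mt hadj.mp (not_or.mpr ⟨hA, hB⟩))).symm
      simp [eval_add, e1, e2, hA, hB]
  · have hm' : t - 3 - φ.vertices h g q * φ.vertices h g q < φ.vertices h g q := by omega
    rw [dif_neg (show ¬ t - 3 < (φ.toCVD code q).n * (φ.toCVD code q).n from hm),
      dif_pos (show t - 3 - (φ.toCVD code q).n * (φ.toCVD code q).n < (φ.toCVD code q).n from hm')]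
    have hS : ∀ v : Fin (φ.vertices h g q), v ∈ (φ.toCVD code q).S ↔
        (v : ℕ) < φ.modulatorSize h g := fun v =>
      ⟨fun hv => (Finset.mem_filter.mp hv).2,
        fun hv => Finset.mem_filter.mpr ⟨Finset.mem_univ _, hv⟩⟩
    have hsub : (sub (sub (var 1) (const 3)) (mul (var 7) (var 7))).eval s =
        t - 3 - φ.vertices h g q * φ.vertices h g q := by
      rw [eval, ht3, hnn]
    simp only [hm, hsub]
    by_cases hlt : t - 3 - φ.vertices h g q * φ.vertices h g q < φ.modulatorSize h g
    · refine Eq.trans ?_ (if_pos ((hS ⟨_, hm'⟩).mpr hlt)).symm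
      simp [hlt]
    · refine Eq.trans ?_ (if_neg (mt (hS ⟨_, hm'⟩).mp hlt)).symm
      simp [hlt]

end CNFFormula

/-! ### The reduction as a program -/

namespace RAM

theorem Stmt.seq_spec {D B : ℕ} {p q : Stmt} {s s' s'' : State}
    (hp : p.Within D B s ∧ p.eval s = s') (hq : q.Within D B s' ∧ q.eval s' = s'') :
    (Stmt.seq p q).Within D B s ∧ (Stmt.seq p q).eval s = s'' := by
  obtain ⟨hp, rfl⟩ := hp
  exact ⟨⟨hp, hq.1⟩, hq.2⟩

theorem Stmt.assign_spec {D B i v : ℕ} {e : Expr} {s : State} (hs : s.BddBy D B)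
    (he : e.eval s = v) :
    (Stmt.assign i e).Within D B s ∧ (Stmt.assign i e).eval s = s.setReg i v :=
  ⟨hs, by rw [← he]; rfl⟩

theorem State.BddBy.setReg {D B i v : ℕ} {s : State} (hs : s.BddBy D B) (hv : v ≤ B) :
    (s.setReg i v).BddBy D B where
  reg j hj := by
    rw [State.reg_setReg]
    split_ifs
    · exact hv
    · exact hs.reg j hj
  arr a j := hs.arr a j

theorem State.reg_fill (s : State) (a i : ℕ) (f : ℕ → ℕ) (k j : ℕ) :
    (s.fill a i f k).reg j = if j = i then k else s.reg j := by
  simp [State.fill, Function.update_apply]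

theorem State.arr_fill_self (s : State) (a i : ℕ) (f : ℕ → ℕ) (k j : ℕ) :
    (s.fill a i f k).arr a j = if j < k then f j else s.arr a j := by
  simp [State.fill]

theorem State.arr_fill_of_ne (s : State) {a b : ℕ} (h : b ≠ a) (i : ℕ) (f : ℕ → ℕ) (k : ℕ) :
    (s.fill a i f k).arr b = s.arr b := by
  simp [State.fill, h]

end RAM

namespace CNFFormula

open RAM Expr

variable {g h : ℕ} (code : BalancedCode g h) (q : ℕ) (φ : CNFFormula)

/-- The program that turns the input word of a formula into the input word of its instance of the
graph problems: it copies the input to array `1`, finds the positions of the clauses, computes the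
sizes and then the cells of the output one by one. -/
def reduction : Stmt :=
  .seq (.fill 1 1 (var 0) (arr 0 (var 1))) <|
  .seq (.assign 2 (arr 1 (const 0))) <|
  .seq (.assign 3 (arr 1 (const 1))) <|
  .seq (.fill 2 1 (var 3) (ite (var 1)
    (add (add (arr 2 (sub (var 1) (const 1))) (const 1)) (arr 1 (arr 2 (sub (var 1) (const 1)))))
    (const 2))) <|
  .seq (.assign 4 (add (div (var 2) (const g)) (const 1))) <|
  .seq (.assign 5 (mul (var 4) (const (2 * h)))) <|
  .seq (.assign 6 (add (const (slots g q)) (add (const 2) (mul (const (slots g q)) (var 5))))) <|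
  .seq (.assign 7 (add (var 5) (mul (mul (add (var 3) (var 4)) (var 5)) (var 6)))) <|
  .seq (.assign 8 (add (mul (var 4) (const h))
    (mul (mul (add (var 3) (var 4)) (var 5)) (const (slots g q - 1))))) <|
  .seq (.assign 0 (add (add (const 3) (mul (var 7) (var 7))) (var 7))) <|
  .fill 0 1 (var 0) (cellExpr code q)

theorem reduction_varsBelow : (reduction code q).VarsBelow 9 := by
  simp [reduction, Stmt.VarsBelow, Stmt.fill, Expr.VarsBelow, cellExpr, edgeExpr, requiresExpr,
    Expr.lt, Expr.eq, Expr.mod]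

/-- The length of the output of the reduction. -/
def outputLength (h g q : ℕ) (φ : CNFFormula) : ℕ :=
  3 + φ.vertices h g q * φ.vertices h g q + φ.vertices h g q

/-- A bound for all numbers in the memory during the reduction. -/
def memoryBound (h g q : ℕ) (φ : CNFFormula) : ℕ :=
  φ.encode.length + φ.encode.sum + φ.blocks g + φ.modulatorSize h g + φ.gadgetSize h g q +
    φ.vertices h g q + φ.budget h g q + φ.outputLength h g q + 1

variable {φ q}

theorem length_encode_le (hq : ∀ c ∈ φ.clauses, c.length ≤ q) :
    φ.encode.length ≤ 2 + φ.clauses.length * (q + 1) := by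
  have : (φ.clauses.map fun c => (encodeClause c).length).sum ≤
      φ.clauses.length • (q + 1) := by
    refine (List.sum_le_card_nsmul _ (q + 1) ?_).trans (by simp)
    intro x hx
    obtain ⟨c, hc, rfl⟩ := List.mem_map.mp hx
    simpa [encodeClause] using hq c hc
  change (φ.n :: φ.clauses.length :: φ.clauses.flatMap encodeClause).length ≤ _
  rw [List.length_cons, List.length_cons, List.length_flatMap]
  simp only [smul_eq_mul] at this
  omega

theorem length_encode_le_outputLength (hq : ∀ c ∈ φ.clauses, c.length ≤ q) (hh : 0 < h) :
    φ.encode.length ≤ φ.outputLength h g q := by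
  have h1 := length_encode_le hq
  have h2 : φ.clauses.length * (q + 1) ≤ φ.vertices h g q := by
    have hk := φ.modulatorSize_pos (g := g) hh
    have hM : q + 1 ≤ φ.gadgetSize h g q := by
      have : (q + 1) * 1 ≤ slots g q := Nat.mul_le_mul_left _ Nat.one_le_two_pow
      rw [gadgetSize]; omega
    have hG : φ.clauses.length ≤ φ.gadgets h g := by
      rw [gadgets]
      calc φ.clauses.length ≤ (φ.clauses.length + φ.blocks g) * 1 := by omega
        _ ≤ _ := Nat.mul_le_mul_left _ hk
    have := Nat.mul_le_mul hG hM
    rw [vertices]; omega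
  rw [outputLength]; omega

theorem reduction_spec (hg : 0 < g) (hh : 0 < h) (hq : ∀ c ∈ φ.clauses, c.length ≤ q) :
    (reduction code q).Within 9 (φ.memoryBound h g q) (initial φ.encode) ∧
    ((reduction code q).eval (initial φ.encode)).reg 0 = (φ.toCVD code q).encode.length ∧
    ((reduction code q).eval (initial φ.encode)).arr 0 =
      fun i => (φ.toCVD code q).encode.getD i 0 := by
  set B := φ.memoryBound h g q with hB
  rw [memoryBound] at hB
  have hlen := φ.length_encode_le_outputLength (g := g) hq hh
  have hout : (φ.toCVD code q).encode.length = φ.outputLength h g q :=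
    CVDInstance.length_encode _
  have hget : ∀ i, φ.encode.getD i 0 ≤ φ.encode.sum := getD_le_sum _
  have hn : φ.encode.getD 0 0 = φ.n := rfl
  have hm : φ.encode.getD 1 0 = φ.clauses.length := rfl
  set s0 := initial φ.encode with hs0
  have r0 : s0.reg 0 = φ.encode.length := rfl
  have a0 : ∀ j, s0.arr 0 j = φ.encode.getD j 0 := fun j => rfl
  have b0 : s0.BddBy 9 B := by
    refine ⟨fun i _ => ?_, fun a j => ?_⟩
    · simp only [hs0, initial]
      split_ifs <;> omega
    · simp only [hs0, initial]
      have := hget j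
      split_ifs <;> omega
  -- the copy of the input
  set s1 := s0.fill 1 1 (fun j => φ.encode.getD j 0) φ.encode.length with hs1
  have p1 := Stmt.fill_spec (D := 9) (B := B) (a := 1) (i := 1) (ℓ := φ.encode.length)
    (len := var 0) (F := arr 0 (var 1)) (s := s0) (fun j => φ.encode.getD j 0) b0
    (by simp [eval, r0]) (by omega)
    (fun k _ => by
      simp only [eval, State.reg_fill, if_true]
      rw [State.arr_fill_of_ne _ (by omega), a0])
    (fun k _ => by have := hget k; omega)
  have b1 : s1.BddBy 9 B := b0.fill (by omega) fun j _ => by have := hget j; omega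
  have a1 : ∀ j, s1.arr 1 j = φ.encode.getD j 0 := by
    intro j
    rw [hs1, State.arr_fill_self]
    split_ifs with hj
    · rfl
    · rw [List.getD_eq_default _ _ (by omega)]
      simp [hs0, initial]
  have p2 := Stmt.assign_spec (i := 2) (e := arr 1 (const 0)) (v := φ.n) b1
    (by simp only [eval, a1, hn])
  set s2 := s1.setReg 2 φ.n with hs2
  have b2 : s2.BddBy 9 B := b1.setReg (by have := hget 0; omega)
  have p3 := Stmt.assign_spec (i := 3) (e := arr 1 (const 1)) (v := φ.clauses.length) b2
    (by simp only [eval, hs2, State.arr_setReg, a1, hm])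
  set s3 := s2.setReg 3 φ.clauses.length with hs3
  have b3 : s3.BddBy 9 B := b2.setReg (by have := hget 1; omega)
  -- the positions of the clauses
  have hpos : ∀ c ≤ φ.clauses.length, clausePos φ.encode c ≤ B := fun c hc => by
    have := φ.clausePos_le hc
    omega
  have p4 := Stmt.fill_spec (D := 9) (B := B) (a := 2) (i := 1) (ℓ := φ.clauses.length)
    (len := var 3) (F := ite (var 1)
      (add (add (arr 2 (sub (var 1) (const 1))) (const 1)) (arr 1 (arr 2 (sub (var 1) (const 1)))))
      (const 2)) (s := s3) (clausePos φ.encode) b3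
    (by simp [eval, hs3]) (by have := hget 1; omega)
    (fun k hk => by
      simp only [eval, State.reg_fill, if_true]
      rcases k with _ | k
      · rfl
      · rw [if_pos (by omega), Nat.add_sub_cancel, State.arr_fill_self, if_pos (by omega),
          State.arr_fill_of_ne _ (by omega), hs3, State.arr_setReg, hs2, State.arr_setReg, a1,
          clausePos])
    (fun k hk => hpos k hk.le)
  set s4 := s3.fill 2 1 (clausePos φ.encode) φ.clauses.length with hs4
  have b4 : s4.BddBy 9 B := b3.fill (by have := hget 1; omega) fun j hj => hpos j hj.le
  have a4 : ∀ j, s4.arr 1 j = φ.encode.getD j 0 := by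
    intro j
    rw [hs4, State.arr_fill_of_ne _ (by omega), hs3, State.arr_setReg, hs2, State.arr_setReg, a1]
  have c4 : ∀ c < φ.clauses.length, s4.arr 2 c = clausePos φ.encode c := by
    intro c hc
    rw [hs4, State.arr_fill_self, if_pos hc]
  have d4 : ∀ j, s4.arr 0 j = φ.encode.getD j 0 := by
    intro j
    rw [hs4, State.arr_fill_of_ne _ (by omega), hs3, State.arr_setReg, hs2, State.arr_setReg, hs1,
      State.arr_fill_of_ne _ (by omega), a0]
  have e4 : s4.reg 2 = φ.n := by simp [hs4, hs3, hs2, State.reg_fill]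
  have f4 : s4.reg 3 = φ.clauses.length := by simp [hs4, hs3, State.reg_fill]
  clear_value s4
  -- the sizes
  have p5 := Stmt.assign_spec (i := 4) (e := add (div (var 2) (const g)) (const 1))
    (v := φ.blocks g) b4 (by simp only [eval, e4]; rfl)
  set s5 := s4.setReg 4 (φ.blocks g) with hs5
  have b5 : s5.BddBy 9 B := b4.setReg (by omega)
  have p6 := Stmt.assign_spec (i := 5) (e := mul (var 4) (const (2 * h)))
    (v := φ.modulatorSize h g) b5 (by simp [eval, hs5, modulatorSize])
  set s6 := s5.setReg 5 (φ.modulatorSize h g) with hs6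
  have b6 : s6.BddBy 9 B := b5.setReg (by omega)
  have p7 := Stmt.assign_spec (i := 6)
    (e := add (const (slots g q)) (add (const 2) (mul (const (slots g q)) (var 5))))
    (v := φ.gadgetSize h g q) b6 (by simp [eval, hs6, gadgetSize])
  set s7 := s6.setReg 6 (φ.gadgetSize h g q) with hs7
  have b7 : s7.BddBy 9 B := b6.setReg (by omega)
  have p8 := Stmt.assign_spec (i := 7)
    (e := add (var 5) (mul (mul (add (var 3) (var 4)) (var 5)) (var 6)))
    (v := φ.vertices h g q) b7 (by simp [eval, hs7, hs6, hs5, f4, vertices, gadgets])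
  set s8 := s7.setReg 7 (φ.vertices h g q) with hs8
  have b8 : s8.BddBy 9 B := b7.setReg (by omega)
  have p9 := Stmt.assign_spec (i := 8) (e := add (mul (var 4) (const h))
    (mul (mul (add (var 3) (var 4)) (var 5)) (const (slots g q - 1))))
    (v := φ.budget h g q) b8 (by simp [eval, hs8, hs7, hs6, hs5, f4, budget, gadgets])
  set s9 := s8.setReg 8 (φ.budget h g q) with hs9
  have b9 : s9.BddBy 9 B := b8.setReg (by omega)
  have p10 := Stmt.assign_spec (i := 0) (e := add (add (const 3) (mul (var 7) (var 7))) (var 7))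
    (v := φ.outputLength h g q) b9 (by simp [eval, hs9, hs8, outputLength])
  set s10 := s9.setReg 0 (φ.outputLength h g q) with hs10
  have b10 : s10.BddBy 9 B := b9.setReg (by omega)
  have harr : s10.arr = s4.arr := rfl
  -- the output
  have hready : ∀ k, φ.Ready h g q
      (s10.fill 0 1 (fun j => (φ.toCVD code q).encode.getD j 0) k) := by
    intro k
    refine ⟨fun j => ?_, fun c hc => ?_, ?_, ?_, ?_, ?_, ?_⟩
    · rw [State.arr_fill_of_ne _ (by omega), harr, a4]
    · rw [State.arr_fill_of_ne _ (by omega), harr, c4 c hc]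
    all_goals simp [State.reg_fill, hs10, hs9, hs8, hs7, hs6, hs5, f4]
  have hcell : ∀ j, (φ.toCVD code q).encode.getD j 0 ≤ B := by
    intro j
    rw [CVDInstance.getD_encode]
    have h1 : (φ.toCVD code q).n = φ.vertices h g q := rfl
    have h2 : (φ.toCVD code q).k = φ.modulatorSize h g := rfl
    have h3 : (φ.toCVD code q).ℓ = φ.budget h g q := rfl
    split_ifs <;> omega
  have p11 := Stmt.fill_spec (D := 9) (B := B) (a := 0) (i := 1) (ℓ := φ.outputLength h g q)
    (len := var 0) (F := cellExpr code q) (s := s10)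
    (fun j => (φ.toCVD code q).encode.getD j 0) b10 (by simp [eval, hs10]) (by omega)
    (fun k hk => eval_cellExpr hg hh (hready k) (by simp [State.reg_fill]) hk)
    (fun k _ => hcell k)
  obtain ⟨hW, hE⟩ := Stmt.seq_spec p1 <| Stmt.seq_spec p2 <| Stmt.seq_spec p3 <|
    Stmt.seq_spec p4 <| Stmt.seq_spec p5 <| Stmt.seq_spec p6 <| Stmt.seq_spec p7 <|
    Stmt.seq_spec p8 <| Stmt.seq_spec p9 <| Stmt.seq_spec p10 p11
  refine ⟨hW, ?_, ?_⟩
  · rw [reduction, hE, hout]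
    simp [State.reg_fill, hs10]
  · rw [reduction, hE]
    ext j
    rw [State.arr_fill_self]
    split_ifs with hj
    · rfl
    · rw [harr, d4, List.getD_eq_default _ _ (by omega), List.getD_eq_default _ _ (by omega)]

end CNFFormula

/-! ### The size of the reduction -/

namespace CNFFormula

open RAM

variable {g h q : ℕ} {φ : CNFFormula}

theorem sum_le_length_mul {l : List ℕ} {B : ℕ} (hl : ∀ x ∈ l, x ≤ B) : l.sum ≤ l.length * B := by
  simpa using List.sum_le_card_nsmul l B hl

theorem sum_encode_le (hq : ∀ c ∈ φ.clauses, c.length ≤ q) :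
    φ.encode.sum ≤ (2 + φ.clauses.length * (q + 1)) *
      (2 * (φ.n + φ.clauses.length) + q + 1) := by
  refine (sum_le_length_mul (B := 2 * (φ.n + φ.clauses.length) + q + 1) ?_).trans
    (Nat.mul_le_mul_right _ (length_encode_le hq))
  intro x hx
  simp only [encode, List.mem_cons, List.mem_flatMap, List.mem_map] at hx
  rcases hx with rfl | rfl | ⟨c, hc, rfl | ⟨l, -, rfl⟩⟩
  · omega
  · omega
  · have := hq c hc
    omega
  · have := l.1.2
    have : l.2.toNat ≤ 1 := Bool.toNat_le l.2
    omega

/-- The numbers in the memory during the reduction are polynomial in the numbers of variables and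
clauses, and so is the length of the output. -/
theorem exists_memoryBound_le (g h q : ℕ) : ∃ f, PolyBdd f ∧ ∀ φ : CNFFormula,
    (∀ c ∈ φ.clauses, c.length ≤ q) → φ.memoryBound h g q ≤ f (φ.n + φ.clauses.length) := by
  let lf : ℕ → ℕ := fun z => 2 + z * (q + 1)
  let sf : ℕ → ℕ := fun z => lf z * (2 * z + q + 1)
  let nf : ℕ → ℕ := fun z => z + 1
  let kf : ℕ → ℕ := fun z => nf z * (2 * h)
  let pf : ℕ → ℕ := fun z => slots g q + (2 + slots g q * kf z)
  let gf : ℕ → ℕ := fun z => (z + nf z) * kf z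
  let vf : ℕ → ℕ := fun z => kf z + gf z * pf z
  let bf : ℕ → ℕ := fun z => nf z * h + gf z * (slots g q - 1)
  let of : ℕ → ℕ := fun z => 3 + vf z * vf z + vf z
  have hlf : PolyBdd lf := (PolyBdd.const 2).add (PolyBdd.id.mul (.const _))
  have hsf : PolyBdd sf :=
    hlf.mul ((((PolyBdd.const 2).mul .id).add (.const q)).add (.const 1))
  have hnf : PolyBdd nf := PolyBdd.id.add (.const 1)
  have hkf : PolyBdd kf := hnf.mul (.const _)
  have hpf : PolyBdd pf := (PolyBdd.const _).add ((PolyBdd.const 2).add ((PolyBdd.const _).mul hkf))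
  have hgf : PolyBdd gf := (PolyBdd.id.add hnf).mul hkf
  have hvf : PolyBdd vf := hkf.add (hgf.mul hpf)
  have hbf : PolyBdd bf := (hnf.mul (.const h)).add (hgf.mul (.const _))
  have hof : PolyBdd of := ((PolyBdd.const 3).add (hvf.mul hvf)).add hvf
  refine ⟨fun z => lf z + sf z + nf z + kf z + pf z + vf z + bf z + of z + 1,
    (((((((hlf.add hsf).add hnf).add hkf).add hpf).add hvf).add hbf).add hof).add (.const 1),
    fun φ hq => ?_⟩
  set z := φ.n + φ.clauses.length with hz
  have hmz : φ.clauses.length ≤ z := by omega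
  have h1 : φ.encode.length ≤ lf z :=
    (length_encode_le hq).trans (Nat.add_le_add_left (Nat.mul_le_mul_right _ hmz) _)
  have h2 : φ.encode.sum ≤ sf z := (sum_encode_le hq).trans
    (Nat.mul_le_mul_right _ (Nat.add_le_add_left (Nat.mul_le_mul_right _ hmz) _))
  have h3 : φ.blocks g ≤ nf z := by
    have := Nat.div_le_self φ.n g
    simp only [blocks, nf]
    omega
  have h4 : φ.modulatorSize h g ≤ kf z := Nat.mul_le_mul_right _ h3
  have h5 : φ.gadgetSize h g q ≤ pf z :=
    Nat.add_le_add_left (Nat.add_le_add_left (Nat.mul_le_mul_left _ h4) _) _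
  have h6 : φ.gadgets h g ≤ gf z := Nat.mul_le_mul (Nat.add_le_add hmz h3) h4
  have h7 : φ.vertices h g q ≤ vf z := Nat.add_le_add h4 (Nat.mul_le_mul h6 h5)
  have h8 : φ.budget h g q ≤ bf z :=
    Nat.add_le_add (Nat.mul_le_mul_right _ h3) (Nat.mul_le_mul_right _ h6)
  have h9 : φ.outputLength h g q ≤ of z :=
    Nat.add_le_add (Nat.add_le_add_left (Nat.mul_le_mul h7 h7) _) h7
  rw [memoryBound]
  beta_reduce
  omega

theorem inputLength_encode_le (code : BalancedCode g h) :
    inputLength (φ.toCVD code q).encode ≤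
      φ.memoryBound h g q * (φ.memoryBound h g q + 1) := by
  have hlen : (φ.toCVD code q).encode.length = φ.outputLength h g q :=
    CVDInstance.length_encode _
  refine (sum_le_length_mul (B := φ.memoryBound h g q + 1) ?_).trans
    (Nat.mul_le_mul_right _ ?_)
  · intro x hx
    obtain ⟨a, ha, rfl⟩ := List.mem_map.mp hx
    have h1 := size_le_self a
    obtain ⟨j, hj, rfl⟩ := List.mem_iff_getElem.mp ha
    rw [← List.getD_eq_getElem _ 0 hj, CVDInstance.getD_encode] at *
    have e1 : (φ.toCVD code q).n = φ.vertices h g q := rfl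
    have e2 : (φ.toCVD code q).k = φ.modulatorSize h g := rfl
    have e3 : (φ.toCVD code q).ℓ = φ.budget h g q := rfl
    refine Nat.succ_le_succ (h1.trans ?_)
    rw [memoryBound]
    split_ifs <;> omega
  · rw [List.length_map, hlen, memoryBound]
    omega

/-- The reduction takes polynomial time and its output has polynomial length. -/
theorem exists_reduction_le (code : BalancedCode g h) (q : ℕ) : ∃ D, ∀ φ : CNFFormula,
    (∀ c ∈ φ.clauses, c.length ≤ q) →
    (reduction code q).time (φ.memoryBound h g q) ≤ (φ.n + φ.clauses.length + 2) ^ D ∧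
    inputLength (φ.toCVD code q).encode ≤ (φ.n + φ.clauses.length + 2) ^ D := by
  obtain ⟨f, hf, hφ⟩ := exists_memoryBound_le g h q
  obtain ⟨T, hT⟩ := (reduction code q).polyBdd_time
  obtain ⟨D, hD⟩ := ((hf.add (.const 2)).pow T).add (hf.mul (hf.add (.const 1)))
  refine ⟨D, fun φ hq => ?_⟩
  have hb := hφ φ hq
  have hz := hD (φ.n + φ.clauses.length)
  have h1 := (hT (φ.memoryBound h g q)).trans (Nat.pow_le_pow_left (Nat.add_le_add_right hb 2) T)
  have h2 := (φ.inputLength_encode_le (q := q) code).trans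
    (Nat.mul_le_mul hb (Nat.add_le_add_right hb 1))
  beta_reduce at hz h1
  constructor <;> omega

end CNFFormula

/-! ### Running times -/

/-- Blocks of `g` variables can be encoded by sets of half the size of `2 * h` points with `2 * h /
g` as close to `1` as required: take `2 * h = 2 ^ s` and `g = 2 ^ s - s`. -/
theorem exists_balancedCode {θ : ℝ} (hθ : θ < 1) : ∃ g h : ℕ, 0 < g ∧ 0 < h ∧
    θ * (2 * h) / g < 1 ∧ Nonempty (BalancedCode g h) := by
  obtain ⟨s, hs1, hs⟩ : ∃ s : ℕ, 1 ≤ s ∧ (s : ℝ) < 2 ^ s * (1 - θ) := by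
    have ht := tendsto_pow_const_div_const_pow_of_one_lt 1 (one_lt_two (α := ℝ))
    have hev := (ht.eventually_lt_const (sub_pos.mpr hθ)).and (Filter.eventually_ge_atTop 1)
    obtain ⟨s, hs, hs1⟩ := hev.exists
    refine ⟨s, hs1, ?_⟩
    rw [pow_one, div_lt_iff₀ (by positivity)] at hs
    linarith
  obtain ⟨r, rfl⟩ := Nat.exists_eq_add_of_le' hs1
  have hlt : r + 1 < 2 ^ (r + 1) := Nat.lt_two_pow_self
  have hg : 0 < 2 ^ (r + 1) - (r + 1) := by omega
  refine ⟨2 ^ (r + 1) - (r + 1), 2 ^ r, hg, by positivity, ?_, ?_⟩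
  · rw [div_lt_one (by exact_mod_cast hg), Nat.cast_sub hlt.le]
    push_cast
    push_cast at hs
    rw [pow_succ] at *
    linarith
  · refine BalancedCode.exists_of_le ?_
    have h4 := Nat.four_pow_le_two_mul_self_mul_centralBinom (2 ^ r) (by positivity)
    have e1 : (4 : ℕ) ^ 2 ^ r = 2 ^ (r + 1) * 2 ^ (2 ^ (r + 1) - (r + 1)) := by
      rw [← pow_add, Nat.add_sub_cancel' hlt.le, show (4 : ℕ) = 2 ^ 2 by norm_num, ← pow_mul,
        pow_succ, mul_comm]
    rw [e1, ← pow_succ'] at h4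
    exact Nat.le_of_mul_le_mul_left h4 (by positivity)

theorem exists_pow_le_rpow (E : ℕ) {η : ℝ} (hη : 0 < η) :
    ∃ C : ℝ, 0 ≤ C ∧ ∀ n : ℕ, ((n : ℝ) + 2) ^ E ≤ C * 2 ^ (η * n) := by
  have hr : (1 : ℝ) < 2 ^ η := Real.one_lt_rpow one_lt_two hη
  have hr0 : (0 : ℝ) < 2 ^ η := by positivity
  obtain ⟨K, hK⟩ := (tendsto_pow_const_div_const_pow_of_one_lt E hr).bddAbove_range
  have hK' : ∀ n : ℕ, (n : ℝ) ^ E / (2 ^ η) ^ n ≤ K := fun n => hK ⟨n, rfl⟩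
  have hK0 : 0 ≤ K := le_trans (by positivity) (hK' 0)
  refine ⟨K * (2 ^ η) ^ 2, by positivity, fun n => ?_⟩
  have := hK' (n + 2)
  rw [div_le_iff₀ (by positivity)] at this
  push_cast at this
  rw [Real.rpow_mul zero_le_two, Real.rpow_natCast, mul_assoc, ← pow_add, add_comm 2 n]
  exact this

theorem pow_modulator_le {b₀ b θ : ℝ} (h0 : 0 ≤ b₀) (hb : b₀ ≤ b) (hb1 : 1 ≤ b) (hbθ : b = 2 ^ θ)
    (hθ : 0 ≤ θ) {g h n : ℕ} :
    b₀ ^ (2 * h + 2 * h * (n / g)) ≤ b ^ (2 * h) * 2 ^ (θ * (2 * h) / g * n) := by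
  have e2 : b ^ (2 * h * (n / g)) ≤ 2 ^ (θ * (2 * h) / g * n) := by
    rw [hbθ, ← Real.rpow_natCast, ← Real.rpow_mul zero_le_two]
    refine Real.rpow_le_rpow_of_exponent_le one_le_two ?_
    have : ((n / g : ℕ) : ℝ) ≤ n / g := Nat.cast_div_le
    calc θ * ((2 * h * (n / g) : ℕ) : ℝ) = θ * (2 * h) * ((n / g : ℕ) : ℝ) := by
          push_cast; ring
      _ ≤ θ * (2 * h) * (n / g) := by gcongr
      _ = θ * (2 * h) / g * n := by ring
  calc b₀ ^ (2 * h + 2 * h * (n / g)) ≤ b ^ (2 * h + 2 * h * (n / g)) :=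
        pow_le_pow_left₀ h0 hb _
    _ = b ^ (2 * h) * b ^ (2 * h * (n / g)) := pow_add _ _ _
    _ ≤ _ := by gcongr

/-- The time of the reduction and of the algorithm for the graph problem together: the polynomial
factor in the number of variables is absorbed by the slack `(1 - c) / 2` of the exponent. -/
theorem total_time_le {c : ℝ} (hc : 0 ≤ c) {C K C₁ x T t L : ℝ} {n m D d : ℕ} (hC : 0 ≤ C)
    (hK : 0 ≤ K) (hL : 0 ≤ L)
    (hx : x ≤ K * 2 ^ (c * n)) (hT : T ≤ ((n : ℝ) + m + 2) ^ D) (hLD : L ≤ ((n : ℝ) + m + 2) ^ D)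
    (ht : t ≤ C * x * L ^ d)
    (hpow : ((n : ℝ) + 2) ^ (D + D * d) ≤ C₁ * 2 ^ ((1 - c) / 2 * n)) :
    T + t ≤ (1 + C * K) * C₁ * 2 ^ ((c + 1) / 2 * n) * ((m : ℝ) + 1) ^ (D + D * d) := by
  set Z : ℝ := (n : ℝ) + m + 2 with hZ
  have hn0 : (0 : ℝ) ≤ n := Nat.cast_nonneg _
  have hm0 : (0 : ℝ) ≤ m := Nat.cast_nonneg _
  have hZ1 : 1 ≤ Z := by linarith
  set X : ℝ := 2 ^ (c * n) with hXdef
  have hX : 1 ≤ X := Real.one_le_rpow one_le_two (mul_nonneg hc hn0)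
  have hX0 : 0 ≤ X := by linarith
  have hZprod : Z ≤ ((n : ℝ) + 2) * ((m : ℝ) + 1) := by
    rw [hZ]
    nlinarith
  have hE : Z ^ (D + D * d) ≤ C₁ * 2 ^ ((1 - c) / 2 * n) * ((m : ℝ) + 1) ^ (D + D * d) := by
    refine (pow_le_pow_left₀ (by linarith) hZprod _).trans ?_
    rw [mul_pow]
    gcongr
  have e3 : X * 2 ^ ((1 - c) / 2 * n) = 2 ^ ((c + 1) / 2 * n) := by
    rw [hXdef, ← Real.rpow_add two_pos]
    ring_nf
  have h1 : Z ^ D ≤ Z ^ (D + D * d) := pow_le_pow_right₀ hZ1 (by omega)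
  have h2 : Z ^ (D * d) ≤ Z ^ (D + D * d) := pow_le_pow_right₀ hZ1 (by omega)
  have h3 : L ^ d ≤ Z ^ (D * d) := by
    rw [pow_mul Z D d]
    exact pow_le_pow_left₀ hL hLD d
  have ht1 : t ≤ C * (K * X) * Z ^ (D + D * d) := by
    refine ht.trans (mul_le_mul (mul_le_mul_of_nonneg_left hx hC) (h3.trans h2) (by positivity) ?_)
    positivity
  have hT1 : T ≤ X * Z ^ (D + D * d) :=
    (hT.trans h1).trans (le_mul_of_one_le_left (by positivity) hX)
  calc T + t ≤ X * Z ^ (D + D * d) + C * (K * X) * Z ^ (D + D * d) := add_le_add hT1 ht1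
    _ = (1 + C * K) * X * Z ^ (D + D * d) := by ring
    _ ≤ (1 + C * K) * X * (C₁ * 2 ^ ((1 - c) / 2 * n) * ((m : ℝ) + 1) ^ (D + D * d)) := by
        gcongr
    _ = _ := by rw [← e3]; ring

theorem RAM.Exec.time_pos {p : RAM.Prog} {s s' : RAM.State} {t : ℕ} (h : RAM.Exec p s t s') :
    0 < t := by
  induction h <;> omega

/-- The instance with a single vertex, which is the modulator. -/
def CVDInstance.single : CVDInstance where
  n := 1
  G := ⊥
  k := 1
  ℓ := 0
  S := Finset.univ
  card_S := rfl
  isCVD := fun m hm => ⟨fun f => (f ⟨0, by omega⟩).2 (Finset.mem_coe.mpr (Finset.mem_univ _))⟩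

/-- A problem on graphs with a given chordal vertex deletion set of size `k` that has the same
answers as satisfiability on the images of formulas cannot be solved in time `O*((2 - ε) ^ k)`
under the Strong Exponential Time Hypothesis. -/
theorem not_solvableInOStar_of_satisfiable (hSETH : SETH) (IsYes : CVDInstance → Prop)
    (hyes : ∀ (g h : ℕ) (code : BalancedCode g h) (q : ℕ) (φ : CNFFormula), 0 < g → 0 < h →
      (∀ c ∈ φ.clauses, c.length ≤ q) → (IsYes (φ.toCVD code q) ↔ φ.Satisfiable))
    (ε : ℝ) (hε : 0 < ε) :
    ¬ (DecisionProblem.mk CVDInstance CVDInstance.encode IsYes).SolvableInOStar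
      CVDInstance.k (2 - ε) := by
  rintro ⟨C, d, p, hp⟩
  have hb0 : 0 < 2 - ε := by
    -- a bound that is not positive for `k = 1` is no running time
    by_contra! hle
    obtain ⟨t, s, hex, -, ht⟩ := hp CVDInstance.single
    have h1 := hex.time_pos
    have h2 : (C : ℝ) * (2 - ε) ^ CVDInstance.single.k *
        (RAM.inputLength CVDInstance.single.encode : ℝ) ^ d ≤ 0 := by
      refine mul_nonpos_of_nonpos_of_nonneg ?_ (by positivity)
      rw [show CVDInstance.single.k = 1 from rfl, pow_one]
      exact mul_nonpos_of_nonneg_of_nonpos (by positivity) hle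
    have h3 : (t : ℝ) ≤ 0 := ht.trans h2
    exact absurd h1 (by exact_mod_cast not_lt.mpr h3)
  -- the base may be assumed to be at least `1`
  set b : ℝ := max (2 - ε) 1 with hb
  have hb1 : 1 ≤ b := le_max_right _ _
  have hb2 : b < 2 := max_lt (by linarith) (by norm_num)
  set θ : ℝ := Real.logb 2 b with hθ
  have hθ0 : 0 ≤ θ := Real.logb_nonneg one_lt_two hb1
  have hθ1 : θ < 1 := by
    rw [hθ, Real.logb_lt_iff_lt_rpow one_lt_two (by linarith)]
    simpa using hb2
  have hbθ : b = 2 ^ θ := (Real.rpow_logb two_pos (by norm_num) (by linarith)).symm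
  obtain ⟨g, h, hg, hh, hgh, ⟨code⟩⟩ := exists_balancedCode hθ1
  set c₀ : ℝ := θ * (2 * h) / g with hc₀
  have hc₀0 : 0 ≤ c₀ := by positivity
  have key : ∀ q, satExponent q ≤ (c₀ + 1) / 2 := by
    intro q
    refine csInf_le ⟨0, fun c hc => hc.1⟩ ⟨by linarith, ?_⟩
    obtain ⟨D, hD⟩ := CNFFormula.exists_reduction_le code q
    obtain ⟨C₁, hC₁, hpow⟩ := exists_pow_le_rpow (D + D * d) (η := (1 - c₀) / 2) (by linarith)
    obtain ⟨N, hN⟩ := p.exists_namesLE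
    refine ⟨⌈(1 + C * b ^ (2 * h)) * C₁⌉₊, D + D * d,
      .seq ((CNFFormula.reduction code q).compile N (N + 9)) p, ?_⟩
    rintro ⟨φ, hφ⟩
    obtain ⟨hW, hreg, harr⟩ := CNFFormula.reduction_spec code hg hh hφ
    obtain ⟨t, s, hex, hans, ht⟩ := hp (φ.toCVD code q)
    obtain ⟨t', s', hex', ht', hs'⟩ := RAM.exists_exec_comp (by norm_num)
      (CNFFormula.reduction_varsBelow code q) hN hW hreg harr hex
    refine ⟨t', s', hex', ?_, ?_⟩
    · rw [hs', hans]
      exact hyes g h code q φ hg hh hφ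
    · obtain ⟨hD1, hD2⟩ := hD φ hφ
      set m := φ.clauses.length with hm
      have hk : (2 - ε) ^ (φ.toCVD code q).k ≤ b ^ (2 * h) * 2 ^ (c₀ * φ.n) := by
        have e1 : (φ.toCVD code q).k = 2 * h + 2 * h * (φ.n / g) := by
          change (φ.n / g + 1) * (2 * h) = _
          ring
        rw [e1]
        exact pow_modulator_le hb0.le (le_max_left _ _) hb1 hbθ hθ0
      have htot := total_time_le (T := (CNFFormula.reduction code q).time (φ.memoryBound h g q))
        hc₀0 (Nat.cast_nonneg C) (by positivity) (Nat.cast_nonneg _) hk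
        (by exact_mod_cast hD1) (by exact_mod_cast hD2) ht (hpow φ.n)
      have ht'' : (t' : ℝ) ≤ (CNFFormula.reduction code q).time (φ.memoryBound h g q) + t := by
        exact_mod_cast ht'
      refine (ht''.trans htot).trans ?_
      have hceil := Nat.le_ceil ((1 + C * b ^ (2 * h)) * C₁)
      exact mul_le_mul_of_nonneg_right (mul_le_mul_of_nonneg_right hceil (by positivity))
        (by positivity)
  have := le_of_tendsto' hSETH key
  linarith

theorem theorem6 (hSETH : SETH) (ε : ℝ) (hε : 0 < ε) :
    ¬ FVSbyCVD.SolvableInOStar CVDInstance.k (2 - ε) ∧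
      ¬ OCTbyCVD.SolvableInOStar CVDInstance.k (2 - ε) :=
  ⟨not_solvableInOStar_of_satisfiable hSETH FVSbyCVD.IsYes
      (fun _ _ code _ _ hg hh hq => CNFFormula.isYes_FVS_iff code hg hh hq) ε hε,
    not_solvableInOStar_of_satisfiable hSETH OCTbyCVD.IsYes
      (fun _ _ code _ _ hg hh hq => CNFFormula.isYes_OCT_iff code hg hh hq) ε hε⟩
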